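/- **Setting.** Manifolds are smooth, finite-dimensional, Hausdorff and second countable; submanifolds are (injectively) immersed, embedded ones being a special case. A *stable Hamiltonian structure* on a $(2n+1)$-dimensional manifold $M$ is a pair $(\omega,\lambda)$ of a closed smooth $2$-form $\omega$ and a smooth $1$-form $\lambda$ such that $\lambda\wedge\omega^n$ vanishes nowhere and $\ker\omega\subseteq\ker d\lambda$. Then $\flat_{\lambda,\omega}(v)=i_v\omega+\lambda(v)\lambda$ is an isomorphism $TM\to T^*M$ with inverse $\sharp_{\lambda,\omega}$; put $\Lambda(\alpha,\beta)=\omega(\sharp_{\lambda,\omega}\alpha,\sharp_{\lambda,\omega}\beta)$, $\sharp_\Lambda(\alpha)=i_\alpha\Lambda$, $\mathcal H=\ker\lambda$, and, for a subspace $\Delta\subseteq T_qM$ with annihilator $\Delta^0$, put $\Delta^{\perp_\Lambda}=\sharp_\Lambda(\Delta^0)$. A submanifold $N$ of $M$ is *horizontal* if $T_qN\subseteq\mathcal H_q$, *coisotropic* if $(T_qN)^{\perp_\Lambda}\subseteq T_qN$, and *Lagrangian* if $(T_qN)^{\perp_\Lambda}=T_qN\cap\mathcal H_q$, for all $q\in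 N$. A submanifold of a symplectic manifold is *Lagrangian* if each of its tangent spaces equals its symplectic orthogonal complement. Submanifolds $L,N$ of $M$ *intersect cleanly* if $L\cap N$ is a submanifold (of $M$, smoothly included in $L$ and in $N$, which is automatic for embedded submanifolds) with $T_q(L\cap N)=T_qL\cap T_qN$ for all $q\in L\cap N$. **Theorem (Horizontal coisotropic reduction in stable Hamiltonian structures).** Let $(M,\omega,\lambda)$ be a manifold with a stable Hamiltonian structure, and let $i:N\to M$ be a horizontal coisotropic submanifold such that the distribution $(TN)^{\perp_\Lambda}$ on $N$ is integrable. Let $\mathcal F$ be the set of its leaves (maximal connected integral manifolds), and suppose that the set of leaves $N/\mathcal F$ carries a manifold structure for which the canonical projection $\pi:N\to N/\mathcal F$ is a smooth submersion. Then: 1. there is a unique symplectic form $\omega_N$ on $N/\mathcal F$ with $\pi^*\omega_N=i^*\omega$; 2. if $L$ is a Lagrangian submanifold of $M$ such that $L$ and $N$ intersect cleanly and $\pi(L\cap N)$ is a submanifold of $N/\mathcal F$, then $\pi(L\cap N)$ is a Lagrangian submanifold of $(N/\mathcal F,\omega_N)$. -/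

import Mathlib

open scoped Manifold ContDiff

noncomputable section

namespace StableHamiltonian

/-! ### Linear algebra on one tangent space -/

section Linear

variable {V : Type*} [AddCommGroup V] [Module ℝ V] [TopologicalSpace V]

/-- A `1`-form on `V` as a linear functional `v ↦ l(v)`. -/
def functional (l : V [⋀^Fin 1]→L[ℝ] ℝ) : V →ₗ[ℝ] ℝ where
  toFun v := l ![v]
  map_add' u v := by
    have h := l.toMultilinearMap.cons_add (![] : Fin 0 → V) u v
    exact h
  map_smul' c v := by
    have h := l.toMultilinearMap.cons_smul (![] : Fin 0 → V) c v
    exact h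

/-- A `2`-form on `V` as a map `V → V^*`, namely `u ↦ i_u ω = ω(u, ·)`. -/
def contraction (w : V [⋀^Fin 2]→L[ℝ] ℝ) : V →ₗ[ℝ] Module.Dual ℝ V :=
  LinearMap.mk₂ ℝ (fun u v => w ![u, v])
    (fun u u' v => w.toMultilinearMap.cons_add ![v] u u')
    (fun c u v => w.toMultilinearMap.cons_smul ![v] c u)
    (fun u v v' => by
      have h := w.toMultilinearMap.map_update_add ![u, v] 1 v v'
      have e : ∀ x, Function.update ![u, v] 1 x = ![u, x] := by
        intro x; ext i; fin_cases i <;> simp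
      rw [e, e, e] at h
      exact h)
    (fun c u v => by
      have h := w.toMultilinearMap.map_update_smul ![u, v] 1 c v
      have e : ∀ x, Function.update ![u, v] 1 x = ![u, x] := by
        intro x; ext i; fin_cases i <;> simp
      rw [e, e] at h
      exact h)

/-- The value of the `(2n+1)`-form `λ ∧ ω^n` (with `ω^n = ω ∧ ⋯ ∧ ω`) on `2n+1` vectors. -/
def wedgePow (l : V [⋀^Fin 1]→L[ℝ] ℝ) (w : V [⋀^Fin 2]→L[ℝ] ℝ) (n : ℕ)
    (v : Fin (2 * n + 1) → V) : ℝ :=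
  (1 / 2 ^ n : ℝ) * ∑ σ : Equiv.Perm (Fin (2 * n + 1)),
    ((Equiv.Perm.sign σ : ℤ) : ℝ) * l ![v (σ 0)] *
      ∏ i : Fin n, w ![v (σ ⟨2 * i + 1, by omega⟩), v (σ ⟨2 * i + 2, by omega⟩)]

/-- `♭_{λ,ω}(v) = i_v ω + λ(v) λ`. -/
def flat (w : V [⋀^Fin 2]→L[ℝ] ℝ) (l : V [⋀^Fin 1]→L[ℝ] ℝ) : V →ₗ[ℝ] Module.Dual ℝ V :=
  contraction w + (functional l).smulRight (functional l)

open Classical in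
/-- `♯_{λ,ω} = ♭_{λ,ω}⁻¹` (with the convention `0` if `♭_{λ,ω}` is not an isomorphism, which never
happens for a stable Hamiltonian structure). -/
def sharp (w : V [⋀^Fin 2]→L[ℝ] ℝ) (l : V [⋀^Fin 1]→L[ℝ] ℝ) : Module.Dual ℝ V →ₗ[ℝ] V :=
  if h : Function.Bijective (flat w l) then (LinearEquiv.ofBijective (flat w l) h).symm else 0

/-- The bivector `Λ(α, β) = ω(♯α, ♯β)`. -/
def bivector (w : V [⋀^Fin 2]→L[ℝ] ℝ) (l : V [⋀^Fin 1]→L[ℝ] ℝ) :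
    Module.Dual ℝ V →ₗ[ℝ] Module.Dual ℝ V →ₗ[ℝ] ℝ :=
  (contraction w).compl₁₂ (sharp w l) (sharp w l)

/-- `♯_Λ(α) = i_α Λ = Λ(α, ·)`, an element of `V^{**} = V`. -/
def sharpBivector [Module.IsReflexive ℝ V] (w : V [⋀^Fin 2]→L[ℝ] ℝ) (l : V [⋀^Fin 1]→L[ℝ] ℝ) :
    Module.Dual ℝ V →ₗ[ℝ] V :=
  (Module.evalEquiv ℝ V).symm.toLinearMap ∘ₗ bivector w l

/-- The `Λ`-orthogonal complement `W^{⊥Λ} = ♯_Λ(W⁰)`, with `W⁰` the annihilator of `W`. -/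
def bivectorOrth [Module.IsReflexive ℝ V] (w : V [⋀^Fin 2]→L[ℝ] ℝ) (l : V [⋀^Fin 1]→L[ℝ] ℝ)
    (W : Submodule ℝ V) : Submodule ℝ V :=
  W.dualAnnihilator.map (sharpBivector w l)

/-- The `ω`-orthogonal complement `W^{⊥ω} = {v | ω(v, u) = 0 for all u ∈ W}`. -/
def formOrth (w : V [⋀^Fin 2]→L[ℝ] ℝ) (W : Submodule ℝ V) : Submodule ℝ V where
  carrier := {v | ∀ u ∈ W, contraction w v u = 0}
  add_mem' ha hb u hu := by simp [ha u hu, hb u hu]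
  zero_mem' u _ := by simp
  smul_mem' c v hv u hu := by simp [hv u hu]

end Linear

/-! ### Differential forms on manifolds -/

section Forms

variable {d e : ℕ}
  {M : Type*} [TopologicalSpace M] [ChartedSpace (EuclideanSpace ℝ (Fin d)) M]
  {N : Type*} [TopologicalSpace N] [ChartedSpace (EuclideanSpace ℝ (Fin e)) N]

instance (x : M) : FiniteDimensional ℝ (TangentSpace (𝓡 d) x) :=
  inferInstanceAs (FiniteDimensional ℝ (EuclideanSpace ℝ (Fin d)))

/-- Fields of alternating `k`-linear forms on the tangent spaces of a `d`-dimensional manifold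
(no regularity yet). -/
abbrev FormField (d : ℕ) (M : Type*) [TopologicalSpace M]
    [ChartedSpace (EuclideanSpace ℝ (Fin d)) M] (k : ℕ) :=
  ∀ x : M, TangentSpace (𝓡 d) x [⋀^Fin k]→L[ℝ] ℝ

/-- The coordinate expression of a form in the chart around `x₀`: its pullback to `ℝ^d` under the
inverse of that chart. -/
def FormField.inChart {k : ℕ} (α : FormField d M k) (x₀ : M) (y : EuclideanSpace ℝ (Fin d)) :
    EuclideanSpace ℝ (Fin d) [⋀^Fin k]→L[ℝ] ℝ :=
  (α ((extChartAt (𝓡 d) x₀).symm y)).compContinuousLinearMap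
    (mfderiv 𝓘(ℝ, EuclideanSpace ℝ (Fin d)) (𝓡 d) (extChartAt (𝓡 d) x₀).symm y)

/-- A form is smooth if all its coordinate expressions are. -/
def FormField.IsSmooth {k : ℕ} (α : FormField d M k) : Prop :=
  ∀ x₀ : M, ContDiffOn ℝ ∞ (α.inChart x₀) (extChartAt (𝓡 d) x₀).target

/-- The exterior derivative, computed in the chart around each point. -/
def FormField.extD {k : ℕ} (α : FormField d M k) : FormField d M (k + 1) := fun x =>
  (extDeriv (α.inChart x) (extChartAt (𝓡 d) x x)).compContinuousLinearMap
    (mfderiv (𝓡 d) 𝓘(ℝ, EuclideanSpace ℝ (Fin d)) (extChartAt (𝓡 d) x) x)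

/-- The pullback `f^* α`. -/
def FormField.pullback {k : ℕ} (f : M → N) (α : FormField e N k) : FormField d M k := fun x =>
  (α (f x)).compContinuousLinearMap (mfderiv (𝓡 d) (𝓡 e) f x)

/-- The image `T_x f (T_x M) ⊆ T_{f x} N` of the tangent space; for an immersed submanifold
`f : M → N` this is the tangent space of the submanifold at `f x`. -/
def tangentImage (d e : ℕ) {M : Type*} [TopologicalSpace M]
    [ChartedSpace (EuclideanSpace ℝ (Fin d)) M] {N : Type*} [TopologicalSpace N]
    [ChartedSpace (EuclideanSpace ℝ (Fin e)) N] (f : M → N) (x : M) :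
    Submodule ℝ (TangentSpace (𝓡 e) (f x)) :=
  LinearMap.range (mfderiv (𝓡 d) (𝓡 e) f x).toLinearMap

/-- `f : M → N` is an (injectively immersed) submanifold of `N`. -/
structure IsSubmanifold (d e : ℕ) {M : Type*} [TopologicalSpace M]
    [ChartedSpace (EuclideanSpace ℝ (Fin d)) M] {N : Type*} [TopologicalSpace N]
    [ChartedSpace (EuclideanSpace ℝ (Fin e)) N] (f : M → N) : Prop where
  immersion : Manifold.IsImmersion (𝓡 d) (𝓡 e) ∞ f
  injective : Function.Injective f

end Forms

/-! ### Distributions, leaves and leaf spaces -/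

section Foliation

variable {d : ℕ} {N : Type*} [TopologicalSpace N] [ChartedSpace (EuclideanSpace ℝ (Fin d)) N]

/-- `A ⊆ N` is (the image of) a connected integral manifold of the distribution `D`: a connected
immersed submanifold whose tangent space at each of its points is the space of the distribution. -/
def IsConnectedIntegralManifold.{u} {d : ℕ} {N : Type u} [TopologicalSpace N]
    [ChartedSpace (EuclideanSpace ℝ (Fin d)) N]
    (D : ∀ x : N, Submodule ℝ (TangentSpace (𝓡 d) x)) (A : Set N) : Prop :=
  ∃ (r : ℕ) (F : Type u) (_ : TopologicalSpace F) (_ : ChartedSpace (EuclideanSpace ℝ (Fin r)) F)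
    (j : F → N), IsManifold (𝓡 r) ∞ F ∧ T2Space F ∧ SecondCountableTopology F ∧
      ConnectedSpace F ∧ IsSubmanifold r d j ∧ (∀ p : F, tangentImage r d j p = D (j p)) ∧
      Set.range j = A

/-- A distribution is integrable if there is an integral manifold through every point. -/
def IsIntegrable (D : ∀ x : N, Submodule ℝ (TangentSpace (𝓡 d) x)) : Prop :=
  ∀ x : N, ∃ A : Set N, x ∈ A ∧ IsConnectedIntegralManifold D A

/-- The leaves of a distribution are its maximal connected integral manifolds. -/
def IsLeaf (D : ∀ x : N, Submodule ℝ (TangentSpace (𝓡 d) x)) (A : Set N) : Prop :=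
  Maximal (IsConnectedIntegralManifold D) A

/-- `π : N → Q` presents `Q` as the set `N/F` of leaves, `π` being the canonical projection: the
fibres of `π` over the points of `Q` are exactly the leaves. -/
def IsLeafProjection (D : ∀ x : N, Submodule ℝ (TangentSpace (𝓡 d) x)) {Q : Type*}
    (π : N → Q) : Prop :=
  {A : Set N | ∃ q : Q, π ⁻¹' {q} = A} = {A : Set N | IsLeaf D A}

end Foliation

/-! ### Stable Hamiltonian and symplectic structures -/

section Structures

/-- `(M, Ω, λ)` is a stable Hamiltonian structure on the `(2n+1)`-dimensional manifold `M`. -/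
structure IsStableHamiltonian {n : ℕ} {M : Type*} [TopologicalSpace M]
    [ChartedSpace (EuclideanSpace ℝ (Fin (2 * n + 1))) M]
    (Ω : FormField (2 * n + 1) M 2) (lam : FormField (2 * n + 1) M 1) : Prop where
  smooth_two : Ω.IsSmooth
  smooth_one : lam.IsSmooth
  closed : ∀ q, Ω.extD q = 0
  /-- `λ ∧ Ω^n` vanishes nowhere. -/
  volume : ∀ q, ∃ v, wedgePow (lam q) (Ω q) n v ≠ 0
  /-- `ker Ω ⊆ ker dλ`. -/
  stable : ∀ q u, (∀ v, Ω q ![u, v] = 0) → ∀ v, lam.extD q ![u, v] = 0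

/-- `Ω` is a symplectic form: smooth, closed and non-degenerate at every point. -/
structure IsSymplectic {d : ℕ} {Q : Type*} [TopologicalSpace Q]
    [ChartedSpace (EuclideanSpace ℝ (Fin d)) Q] (Ω : FormField d Q 2) : Prop where
  smooth : Ω.IsSmooth
  closed : ∀ q, Ω.extD q = 0
  nondegenerate : ∀ q, Function.Bijective (contraction (Ω q))

/-- A submanifold of a symplectic manifold is Lagrangian if its tangent spaces are equal to their
symplectic orthogonal complements. -/
def IsLagrangianSymplectic {d s : ℕ} {Q : Type*} [TopologicalSpace Q]
    [ChartedSpace (EuclideanSpace ℝ (Fin d)) Q] {S : Type*} [TopologicalSpace S]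
    [ChartedSpace (EuclideanSpace ℝ (Fin s)) S] (Ω : FormField d Q 2) (f : S → Q) : Prop :=
  ∀ x, formOrth (Ω (f x)) (tangentImage s d f x) = tangentImage s d f x

variable {n k : ℕ} {M : Type*} [TopologicalSpace M]
  [ChartedSpace (EuclideanSpace ℝ (Fin (2 * n + 1))) M]
  {N : Type*} [TopologicalSpace N] [ChartedSpace (EuclideanSpace ℝ (Fin k)) N]

/-- `(T_x N)^{⊥Λ} ⊆ T_{i x} M`. -/
def tangentOrth (Ω : FormField (2 * n + 1) M 2) (lam : FormField (2 * n + 1) M 1)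
    (i : N → M) (x : N) : Submodule ℝ (TangentSpace (𝓡 (2 * n + 1)) (i x)) :=
  bivectorOrth (Ω (i x)) (lam (i x)) (tangentImage k (2 * n + 1) i x)

/-- The submanifold is horizontal: `T_x N ⊆ H = ker λ`. -/
def IsHorizontal (lam : FormField (2 * n + 1) M 1) (i : N → M) : Prop :=
  ∀ x, tangentImage k (2 * n + 1) i x ≤ LinearMap.ker (functional (lam (i x)))

/-- The submanifold is coisotropic: `(T_x N)^{⊥Λ} ⊆ T_x N`. -/
def IsCoisotropic (Ω : FormField (2 * n + 1) M 2) (lam : FormField (2 * n + 1) M 1)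
    (i : N → M) : Prop :=
  ∀ x, tangentOrth (k := k) Ω lam i x ≤ tangentImage k (2 * n + 1) i x

/-- The submanifold is Lagrangian: `(T_x L)^{⊥Λ} = T_x L ∩ H`. -/
def IsLagrangian (Ω : FormField (2 * n + 1) M 2) (lam : FormField (2 * n + 1) M 1)
    (i : N → M) : Prop :=
  ∀ x, tangentOrth (k := k) Ω lam i x =
    tangentImage k (2 * n + 1) i x ⊓ LinearMap.ker (functional (lam (i x)))

/-- The distribution `(TN)^{⊥Λ}` as a distribution on `N`, for a coisotropic submanifold
`i : N → M`. -/
def characteristicDistribution (Ω : FormField (2 * n + 1) M 2) (lam : FormField (2 * n + 1) M 1)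
    (i : N → M) (x : N) : Submodule ℝ (TangentSpace (𝓡 k) x) :=
  (tangentOrth (k := k) Ω lam i x).comap (mfderiv (𝓡 k) (𝓡 (2 * n + 1)) i x).toLinearMap

/-- The submanifolds `iL : L → M` and `iN : N → M` intersect cleanly, and `P`, with the inclusions
`jL : P → L` and `jN : P → N`, is their intersection: it is a submanifold of `M` with image `L ∩ N`
and tangent spaces `TL ∩ TN`. (If `L`, `N` and `P` are embedded in `M`, then `jL` and `jN` are
automatically smooth.) -/
structure IsCleanIntersection {d l k p : ℕ} {M : Type*} [TopologicalSpace M]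
    [ChartedSpace (EuclideanSpace ℝ (Fin d)) M]
    {L : Type*} [TopologicalSpace L] [ChartedSpace (EuclideanSpace ℝ (Fin l)) L]
    {N : Type*} [TopologicalSpace N] [ChartedSpace (EuclideanSpace ℝ (Fin k)) N]
    {P : Type*} [TopologicalSpace P] [ChartedSpace (EuclideanSpace ℝ (Fin p)) P]
    (iL : L → M) (iN : N → M) (jL : P → L) (jN : P → N) : Prop where
  smooth_left : ContMDiff (𝓡 p) (𝓡 l) ∞ jL
  smooth_right : ContMDiff (𝓡 p) (𝓡 k) ∞ jN
  comm : ∀ z, iL (jL z) = iN (jN z)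
  submanifold : IsSubmanifold p d (fun z => iN (jN z))
  range_eq : Set.range (fun z => iN (jN z)) = Set.range iL ∩ Set.range iN
  tangent : ∀ z, tangentImage p d (fun z => iN (jN z)) z =
    tangentImage l d iL (jL z) ⊓ tangentImage k d iN (jN z)

end Structures

end StableHamiltonian

end

open StableHamiltonian

open StableHamiltonian

noncomputable section

open Set
open scoped Topology

namespace StableHamiltonian

/-! ### Linear algebra of a stable Hamiltonian structure at one point. -/

section LinearLemmas

variable {V : Type*} [AddCommGroup V] [Module ℝ V] [TopologicalSpace V]

/-! Everything linear rests on the formula `bivectorOrth_eq`: with `H = ker λ`, the space `W^{⊥Λ}`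
consists of the `v ∈ H` with `ω(v, ·) = 0` on `W ∩ H`. On a horizontal coisotropic `N` the
distribution `(TN)^{⊥Λ}` is therefore exactly the kernel of `i^*ω`.

Existence and uniqueness of the reduced form. The kernel of `dπ` is the characteristic distribution
(`IsLeafProjection.ker_mfderiv_eq`), so at each `x ∈ N` the form `i^*ω` descends to a form `η x` on
the tangent space at `π x`. In a chart where `π` is a linear projection, a closed form killed by
vertical vectors has vanishing vertical derivative, so `η` is locally constant along the fibres
(`descend_locally_eq`); the fibres are connected leaves, so `η` depends on `π x` only. Pulling
`i^*ω` back by local sections of `π` shows that the reduced form is smooth and closed. It is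
non-degenerate because the whole kernel of `i^*ω` has been divided out, and it is unique because `π`
is a surjective submersion.

Lagrangian part, pointwise. By cleanness the map `g = π ∘ jN` has tangential image `dπ(TL ∩ TN)`.
The identity `(C ∩ W)^{⊥Λ} = C^{⊥Λ} + W^{⊥Λ}` shows that this image is Lagrangian
(`formOrth_map_eq_of_reduction`).

Passing to the submanifold `S`. Only the sets `range f` and `range g` agree, where `f : S → Q` is
the immersion; since `S` is merely immersed, `g` is not assumed to factor smoothly, or even
continuously, through `S`. However, `g` has constant rank `m / 2`. The constant rank theorem and
Baire's theorem give `range df ⊆ range dg` at a dense set of points of `S`, so the pullback of the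
reduced form to `S` vanishes there, and by continuity everywhere: `S` is isotropic. A Hausdorff
dimension argument gives `s ≥ m / 2`, and an isotropic space of at least half the dimension is
Lagrangian. -/

@[simp] theorem contraction_apply (w : V [⋀^Fin 2]→L[ℝ] ℝ) (u v : V) :
    contraction w u v = w ![u, v] := rfl

theorem twoForm_swap (w : V [⋀^Fin 2]→L[ℝ] ℝ) (u v : V) : w ![u, v] = -w ![v, u] := by
  have h := w.toAlternatingMap.map_swap ![v, u] (show (0 : Fin 2) ≠ 1 by decide)
  have e : ![v, u] ∘ Equiv.swap (0 : Fin 2) 1 = ![u, v] := by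
    ext i; fin_cases i <;> simp
  rw [e] at h
  exact h

theorem contraction_isAlt (w : V [⋀^Fin 2]→L[ℝ] ℝ) : (contraction w).IsAlt := fun v => by
  have := twoForm_swap w v v
  simp only [contraction_apply]
  linarith

/-- The integrand of `wedgePow` depends linearly on each of its arguments. -/
theorem exists_linear_wedge_update (l : V [⋀^Fin 1]→L[ℝ] ℝ) (w : V [⋀^Fin 2]→L[ℝ] ℝ) (n : ℕ)
    [DecidableEq (Fin (2 * n + 1))] (v : Fin (2 * n + 1) → V) (j : Fin (2 * n + 1)) :
    ∃ g : V →ₗ[ℝ] ℝ, ∀ x, functional l (Function.update v j x 0) *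
      ∏ i : Fin n, contraction w (Function.update v j x ⟨2 * i + 1, by omega⟩)
        (Function.update v j x ⟨2 * i + 2, by omega⟩) = g x := by
  have upd : ∀ (x : V) (a : Fin (2 * n + 1)), a ≠ j → Function.update v j x a = v a :=
    fun x a h => Function.update_of_ne h _ _
  have same : ∀ (x : V) (a : Fin (2 * n + 1)), a = j → Function.update v j x a = x :=
    fun x a h => by subst h; simp
  by_cases h0 : (0 : Fin (2 * n + 1)) = j
  · refine ⟨(∏ i : Fin n, contraction w (v ⟨2 * i + 1, by omega⟩)
      (v ⟨2 * i + 2, by omega⟩)) • functional l, fun x => ?_⟩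
    rw [same x 0 h0, LinearMap.smul_apply, smul_eq_mul, mul_comm]
    congr 1
    refine Finset.prod_congr rfl fun i _ => ?_
    rw [upd, upd] <;> (rw [← h0]; simp [Fin.ext_iff])
  have hj0 : (j : ℕ) ≠ 0 := fun h => h0 (Fin.ext (by simp [h]))
  -- A position `j ≥ 1` occurs only in the factor with arguments `2 * i + 1` and `2 * i + 2` for `i
  -- = (j - 1) / 2`: as second argument if `j` is even, as first if it is odd.
  obtain ⟨i₀, hi₀⟩ : ∃ i₀ : Fin n, (i₀ : ℕ) = ((j : ℕ) - 1) / 2 :=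
    ⟨⟨((j : ℕ) - 1) / 2, by omega⟩, rfl⟩
  have hrest : ∀ x, ∏ i ∈ Finset.univ.erase i₀,
      contraction w (Function.update v j x ⟨2 * i + 1, by omega⟩)
        (Function.update v j x ⟨2 * i + 2, by omega⟩) =
      ∏ i ∈ Finset.univ.erase i₀, contraction w (v ⟨2 * i + 1, by omega⟩)
        (v ⟨2 * i + 2, by omega⟩) := fun x => by
    refine Finset.prod_congr rfl fun i hi => ?_
    have hne : (i : ℕ) ≠ i₀ := fun h => (Finset.ne_of_mem_erase hi) (Fin.ext h)
    rw [upd, upd] <;> (rw [Ne, Fin.ext_iff]; simp only; omega)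
  rcases Nat.even_or_odd' (j : ℕ) with ⟨c, hc | hc⟩
  · refine ⟨(functional l (v 0) * ∏ i ∈ Finset.univ.erase i₀,
      contraction w (v ⟨2 * i + 1, by omega⟩) (v ⟨2 * i + 2, by omega⟩)) •
        contraction w (v ⟨2 * i₀ + 1, by omega⟩), fun x => ?_⟩
    rw [← Finset.mul_prod_erase _ _ (Finset.mem_univ i₀), hrest, upd x 0 h0,
      upd x ⟨2 * i₀ + 1, _⟩ (by rw [Ne, Fin.ext_iff]; simp only; omega),
      same x ⟨2 * i₀ + 2, _⟩ (by rw [Fin.ext_iff]; simp only; omega), LinearMap.smul_apply,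
      smul_eq_mul]
    ring
  · refine ⟨(functional l (v 0) * ∏ i ∈ Finset.univ.erase i₀,
      contraction w (v ⟨2 * i + 1, by omega⟩) (v ⟨2 * i + 2, by omega⟩)) •
        (contraction w).flip (v ⟨2 * i₀ + 2, by omega⟩), fun x => ?_⟩
    rw [← Finset.mul_prod_erase _ _ (Finset.mem_univ i₀), hrest, upd x 0 h0,
      same x ⟨2 * i₀ + 1, _⟩ (by rw [Fin.ext_iff]; simp only; omega),
      upd x ⟨2 * i₀ + 2, _⟩ (by rw [Ne, Fin.ext_iff]; simp only; omega), LinearMap.smul_apply,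
      smul_eq_mul, LinearMap.flip_apply]
    ring

/-- The multilinear map whose alternatization is `2 ^ n λ ∧ ω^n`. -/
def wedgeMultilinear (l : V [⋀^Fin 1]→L[ℝ] ℝ) (w : V [⋀^Fin 2]→L[ℝ] ℝ) (n : ℕ) :
    MultilinearMap ℝ (fun _ : Fin (2 * n + 1) => V) ℝ where
  toFun v := functional l (v 0) *
    ∏ i : Fin n, contraction w (v ⟨2 * i + 1, by omega⟩) (v ⟨2 * i + 2, by omega⟩)
  map_update_add' v j x y := by
    obtain ⟨g, hg⟩ := exists_linear_wedge_update l w n v j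
    rw [hg, hg, hg, map_add]
  map_update_smul' v j c x := by
    obtain ⟨g, hg⟩ := exists_linear_wedge_update l w n v j
    rw [hg, hg, map_smul]

theorem alternatization_wedgeMultilinear (l : V [⋀^Fin 1]→L[ℝ] ℝ) (w : V [⋀^Fin 2]→L[ℝ] ℝ) (n : ℕ)
    (v : Fin (2 * n + 1) → V) :
    wedgePow l w n v =
      (1 / 2 ^ n : ℝ) * MultilinearMap.alternatization (wedgeMultilinear l w n) v := by
  rw [wedgePow, MultilinearMap.alternatization_apply]
  congr 1
  refine Finset.sum_congr rfl fun σ _ => ?_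
  rw [mul_assoc, Units.smul_def, zsmul_eq_mul]
  rfl

/-- If `λ ∧ ω^n` does not vanish on the `(2n+1)`-dimensional space `V`, then
`ker ω ∩ ker λ = 0`. -/
theorem eq_zero_of_wedgePow_ne_zero {n : ℕ} (hV : Module.finrank ℝ V = 2 * n + 1)
    {l : V [⋀^Fin 1]→L[ℝ] ℝ} {w : V [⋀^Fin 2]→L[ℝ] ℝ} (h : ∃ v, wedgePow l w n v ≠ 0)
    {u : V} (hl : functional l u = 0) (hw : contraction w u = 0) : u = 0 := by
  obtain ⟨v, hv⟩ := h
  by_contra hu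
  have : FiniteDimensional ℝ V := Module.finite_of_finrank_eq_succ hV
  obtain ⟨f, hf⟩ := (ℝ ∙ u).exists_isCompl
  -- Project along the line of `u` onto a complement. As `u` lies in both kernels, applying `p` to
  -- all arguments does not change the forms; but `2n + 1` vectors in a `2n`-dimensional space are
  -- dependent, so the top form would vanish.
  let p : V →ₗ[ℝ] V := f.subtype ∘ₗ f.projectionOnto (ℝ ∙ u) hf.symm
  have hp : ∀ x, ∃ c : ℝ, x = p x + c • u := fun x => by
    have hx : f.projectionOnto (ℝ ∙ u) hf.symm (x - p x) = 0 := by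
      rw [map_sub, sub_eq_zero]
      exact (Submodule.projectionOnto_apply_left hf.symm _).symm
    obtain ⟨c, hc⟩ := Submodule.mem_span_singleton.1
      ((Submodule.projectionOnto_apply_eq_zero_iff hf.symm).1 hx)
    exact ⟨c, by rw [hc]; abel⟩
  have hw' : ∀ x, contraction w x u = 0 := fun x => by
    rw [← (contraction_isAlt w).neg, hw]; simp
  have hlp : ∀ x, functional l x = functional l (p x) := fun x => by
    obtain ⟨c, hc⟩ := hp x
    conv_lhs => rw [hc, map_add, map_smul, hl, smul_zero, add_zero]
  have hwp : ∀ x y, contraction w x y = contraction w (p x) (p y) := fun x y => by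
    obtain ⟨c, hc⟩ := hp x
    obtain ⟨d, hd⟩ := hp y
    conv_lhs => rw [hc, hd]
    simp only [map_add, map_smul, LinearMap.add_apply, LinearMap.smul_apply, hw, hw']
    simp
  have heq : wedgePow l w n v = wedgePow l w n (p ∘ v) := by
    have e1 : ∀ x, l ![x] = l ![p x] := hlp
    have e2 : ∀ x y, w ![x, y] = w ![p x, p y] := hwp
    simp only [wedgePow, Function.comp_apply, ← e1, ← e2]
  refine hv ?_
  rw [heq, alternatization_wedgeMultilinear, AlternatingMap.map_linearDependent, mul_zero]
  intro hli
  have hspan : Submodule.span ℝ (Set.range (p ∘ v)) ≤ f := by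
    rw [Submodule.span_le]
    rintro _ ⟨i, rfl⟩
    exact Submodule.coe_mem _
  have h1 := Submodule.finrank_mono hspan
  rw [finrank_span_eq_card hli, Fintype.card_fin] at h1
  have h2 := Submodule.finrank_add_eq_of_isCompl hf
  rw [finrank_span_singleton hu, hV] at h2
  omega

/-- The Reeb vector. -/
theorem exists_reeb {n : ℕ} (hV : Module.finrank ℝ V = 2 * n + 1)
    {l : V [⋀^Fin 1]→L[ℝ] ℝ} {w : V [⋀^Fin 2]→L[ℝ] ℝ} (h : ∃ v, wedgePow l w n v ≠ 0) :
    ∃ R : V, functional l R = 1 ∧ contraction w R = 0 := by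
  have : FiniteDimensional ℝ V := Module.finite_of_finrank_eq_succ hV
  -- A skew-symmetric matrix of odd size has determinant zero.
  have hninj : ¬ Function.Injective (contraction w) := by
    intro hinj
    let b := Module.finBasisOfFinrankEq ℝ V hV
    have hdet := (LinearMap.BilinForm.nondegenerate_iff_det_ne_zero
      (B := (contraction w : LinearMap.BilinForm ℝ V)) b).1 ?_
    · refine hdet ?_
      set A := LinearMap.BilinForm.toMatrix b (contraction w : LinearMap.BilinForm ℝ V)
      have hA : A.transpose = -A := by
        ext i j
        simp only [A, Matrix.transpose_apply, Matrix.neg_apply, LinearMap.BilinForm.toMatrix_apply]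
        rw [← (contraction_isAlt w).neg]
      have h2 : A.det = -A.det := by
        conv_lhs => rw [← Matrix.det_transpose, hA, Matrix.det_neg, Fintype.card_fin,
          Odd.neg_one_pow ⟨n, rfl⟩]
        ring
      linarith
    · exact LinearMap.BilinForm.nondegenerate_iff_ker_eq_bot.2 (LinearMap.ker_eq_bot.2 hinj)
  obtain ⟨R, hR, hR0⟩ : ∃ R, contraction w R = 0 ∧ R ≠ 0 := by
    by_contra! hcon
    exact hninj ((injective_iff_map_eq_zero _).2 hcon)
  have hlR : functional l R ≠ 0 := fun h0 => hR0 (eq_zero_of_wedgePow_ne_zero hV h h0 hR)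
  exact ⟨(functional l R)⁻¹ • R, by rw [map_smul, smul_eq_mul, inv_mul_cancel₀ hlR],
    by rw [map_smul, hR, smul_zero]⟩

/-- Evaluating `♭ v = 0` at the Reeb vector gives `λ(v) = 0`; then `v ∈ ker ω ∩ ker λ = 0`, and
dimensions agree. -/
theorem flat_bijective {n : ℕ} (hV : Module.finrank ℝ V = 2 * n + 1)
    {l : V [⋀^Fin 1]→L[ℝ] ℝ} {w : V [⋀^Fin 2]→L[ℝ] ℝ} (h : ∃ v, wedgePow l w n v ≠ 0) :
    Function.Bijective (flat w l) := by
  have : FiniteDimensional ℝ V := Module.finite_of_finrank_eq_succ hV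
  obtain ⟨R, hR1, hR2⟩ := exists_reeb hV h
  have hinj : Function.Injective (flat w l) := by
    refine (injective_iff_map_eq_zero _).2 fun v hv => ?_
    have happ : ∀ x, contraction w v x + functional l v * functional l x = 0 := fun x => by
      have := LinearMap.congr_fun hv x
      simpa [flat] using this
    have hlv : functional l v = 0 := by
      have := happ R
      rw [hR1, mul_one, ← (contraction_isAlt w).neg, hR2] at this
      simpa using this
    refine eq_zero_of_wedgePow_ne_zero hV h hlv (LinearMap.ext fun x => ?_)
    have := happ x
    rwa [hlv, zero_mul, add_zero] at this
  exact ⟨hinj, (LinearMap.injective_iff_surjective_of_finrank_eq_finrank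
    (Subspace.dual_finrank_eq).symm).1 hinj⟩

theorem flat_sharp {n : ℕ} (hV : Module.finrank ℝ V = 2 * n + 1)
    {l : V [⋀^Fin 1]→L[ℝ] ℝ} {w : V [⋀^Fin 2]→L[ℝ] ℝ} (h : ∃ v, wedgePow l w n v ≠ 0)
    (α : Module.Dual ℝ V) : flat w l (sharp w l α) = α := by
  rw [sharp, dif_pos (flat_bijective hV h)]
  exact (LinearEquiv.ofBijective (flat w l) (flat_bijective hV h)).apply_symm_apply α

/-- `♯_Λ α = α(R) R - ♯ α`, with `R` the Reeb vector. -/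
theorem sharpBivector_eq [Module.IsReflexive ℝ V] {n : ℕ} (hV : Module.finrank ℝ V = 2 * n + 1)
    {l : V [⋀^Fin 1]→L[ℝ] ℝ} {w : V [⋀^Fin 2]→L[ℝ] ℝ} (h : ∃ v, wedgePow l w n v ≠ 0)
    {R : V} (hR1 : functional l R = 1) (hR2 : contraction w R = 0) (α : Module.Dual ℝ V) :
    sharpBivector w l α = α R • R - sharp w l α := by
  have hfs : ∀ β : Module.Dual ℝ V, ∀ x,
      contraction w (sharp w l β) x + functional l (sharp w l β) * functional l x = β x :=
    fun β x => by
      have := LinearMap.congr_fun (flat_sharp hV h β) x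
      simpa [flat] using this
  -- The equation `♭(♯β) = β`, evaluated at the Reeb vector, leaves only the `λ`-term.
  have hlR : ∀ β : Module.Dual ℝ V, functional l (sharp w l β) = β R := fun β => by
    have := hfs β R
    rw [hR1, mul_one, ← (contraction_isAlt w).neg, hR2] at this
    simpa using this
  rw [sharpBivector, LinearMap.comp_apply, LinearEquiv.coe_coe, LinearEquiv.symm_apply_eq]
  ext β
  rw [Module.evalEquiv_apply, Module.Dual.eval_apply, map_sub, map_smul, smul_eq_mul]
  have h1 := hfs β (sharp w l α)
  rw [hlR, hlR] at h1
  change contraction w (sharp w l α) (sharp w l β) = _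
  rw [← (contraction_isAlt w).neg, ← h1]
  ring

/-- `W^{⊥Λ}` is the `ω`-orthogonal complement of `W ∩ ker λ` within `ker λ`. -/
theorem bivectorOrth_eq [Module.IsReflexive ℝ V] {n : ℕ} (hV : Module.finrank ℝ V = 2 * n + 1)
    {l : V [⋀^Fin 1]→L[ℝ] ℝ} {w : V [⋀^Fin 2]→L[ℝ] ℝ} (h : ∃ v, wedgePow l w n v ≠ 0)
    (W : Submodule ℝ V) :
    bivectorOrth w l W =
      LinearMap.ker (functional l) ⊓ formOrth w (W ⊓ LinearMap.ker (functional l)) := by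
  obtain ⟨R, hR1, hR2⟩ := exists_reeb hV h
  have key := sharpBivector_eq hV h hR1 hR2
  have hfs : ∀ β : Module.Dual ℝ V, ∀ x,
      contraction w (sharp w l β) x + functional l (sharp w l β) * functional l x = β x :=
    fun β x => by
      have := LinearMap.congr_fun (flat_sharp hV h β) x
      simpa [flat] using this
  have hlR : ∀ β : Module.Dual ℝ V, functional l (sharp w l β) = β R := fun β => by
    have := hfs β R
    rw [hR1, mul_one, ← (contraction_isAlt w).neg, hR2] at this
    simpa using this
  apply le_antisymm
  · rintro _ ⟨α, hα, rfl⟩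
    rw [key]
    refine ⟨?_, fun x hx => ?_⟩
    · rw [SetLike.mem_coe, LinearMap.mem_ker, map_sub, map_smul, hR1, hlR, smul_eq_mul, mul_one,
        sub_self]
    · have hx2 : functional l x = 0 := hx.2
      have h1 := hfs α x
      rw [hx2, mul_zero, add_zero, (Submodule.mem_dualAnnihilator α).1 hα x hx.1] at h1
      rw [map_sub, map_smul, hR2, smul_zero, zero_sub, LinearMap.neg_apply, h1, neg_zero]
  · rintro v ⟨hv1, hv2⟩
    rw [SetLike.mem_coe, LinearMap.mem_ker] at hv1
    -- the functional `ω(v, ·)` agrees on `W` with a multiple of `λ`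
    obtain ⟨c, hc⟩ : ∃ c : ℝ, ∀ x ∈ W, contraction w v x = c * functional l x := by
      by_cases hWl : ∀ x ∈ W, functional l x = 0
      · exact ⟨0, fun x hx => by rw [zero_mul]; exact hv2 x ⟨hx, hWl x hx⟩⟩
      · push Not at hWl
        obtain ⟨y, hy, hly⟩ := hWl
        refine ⟨contraction w v y / functional l y, fun x hx => ?_⟩
        have hz := hv2 (x - (functional l x / functional l y) • y)
          ⟨W.sub_mem hx (W.smul_mem _ hy), by
            rw [SetLike.mem_coe, LinearMap.mem_ker, map_sub, map_smul, smul_eq_mul,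
              div_mul_cancel₀ _ hly, sub_self]⟩
        rw [map_sub, map_smul, smul_eq_mul, sub_eq_zero] at hz
        rw [hz]
        ring
    -- The functional `ω(v, ·) - cλ` annihilates `W`. Its `♯` is `v - cR` and its value at `R` is
    -- `-c`, so `♯_Λ` sends it to `-v`.
    have hflat : flat w l (v - c • R) = contraction w v - c • functional l := by
      ext x
      simp only [flat, LinearMap.add_apply, map_sub, map_smul, hR2,
        LinearMap.smulRight_apply, hR1, hv1, smul_eq_mul, LinearMap.sub_apply, LinearMap.zero_apply,
        LinearMap.smul_apply]
      ring
    have hsharp : sharp w l (contraction w v - c • functional l) = v - c • R :=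
      (flat_bijective hV h).1 (by rw [flat_sharp hV h, hflat])
    have hmem : contraction w v - c • functional l ∈ W.dualAnnihilator := by
      rw [Submodule.mem_dualAnnihilator]
      intro x hx
      rw [LinearMap.sub_apply, hc x hx, LinearMap.smul_apply, smul_eq_mul, sub_self]
    have hvR : contraction w v R = 0 := by
      rw [← (contraction_isAlt w).neg, hR2]; simp
    have := Submodule.mem_map_of_mem (f := sharpBivector w l) hmem
    rw [key, hsharp, LinearMap.sub_apply, LinearMap.smul_apply, hvR, hR1, smul_eq_mul, mul_one,
      zero_sub] at this
    have h3 : -c • R - (v - c • R) = -v := by module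
    rw [h3] at this
    simpa [bivectorOrth] using this

/-- In finite dimension the annihilator of an intersection is the sum of the annihilators, and
linear images commute with sums. -/
theorem bivectorOrth_inf [FiniteDimensional ℝ V] (w : V [⋀^Fin 2]→L[ℝ] ℝ)
    (l : V [⋀^Fin 1]→L[ℝ] ℝ) (W W' : Submodule ℝ V) :
    bivectorOrth w l (W ⊓ W') = bivectorOrth w l W ⊔ bivectorOrth w l W' := by
  rw [bivectorOrth, Subspace.dualAnnihilator_inf_eq, Submodule.map_sup, bivectorOrth, bivectorOrth]

end LinearLemmas

/-! ### Linear symplectic and Lagrangian reduction. -/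

section LinearReduction

variable {V : Type*} [AddCommGroup V] [Module ℝ V] [TopologicalSpace V] [FiniteDimensional ℝ V]
  {X : Type*} [AddCommGroup X] [Module ℝ X]
  {Y : Type*} [AddCommGroup Y] [Module ℝ Y] [TopologicalSpace Y]
  {n : ℕ} {w : V [⋀^Fin 2]→L[ℝ] ℝ} {l : V [⋀^Fin 1]→L[ℝ] ℝ} {A : X →ₗ[ℝ] V} {p : X →ₗ[ℝ] Y}

/-- Reduction of a horizontal subspace `range A` by `ker p = (range A)^{⊥Λ}`: the reduced form is
non-degenerate. -/
theorem contraction_injective_of_reduction (hV : Module.finrank ℝ V = 2 * n + 1)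
    (h : ∃ v, wedgePow l w n v ≠ 0) (hhor : LinearMap.range A ≤ LinearMap.ker (functional l))
    (hp : Function.Surjective p)
    (hker : LinearMap.ker p = (bivectorOrth w l (LinearMap.range A)).comap A)
    {σ : Y [⋀^Fin 2]→L[ℝ] ℝ} (hσ : ∀ u v, σ ![p u, p v] = w ![A u, A v]) :
    Function.Injective (contraction σ) := by
  refine (injective_iff_map_eq_zero _).2 fun y hy => ?_
  obtain ⟨x, rfl⟩ := hp y
  rw [← LinearMap.mem_ker, hker, Submodule.mem_comap, bivectorOrth_eq hV h]
  refine ⟨hhor ⟨x, rfl⟩, ?_⟩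
  rintro _ ⟨⟨z, rfl⟩, -⟩
  rw [contraction_apply, ← hσ]
  exact LinearMap.congr_fun hy (p z)

/-- Vectors in the kernel of the reduction are in the kernel of the form. -/
theorem form_eq_zero_of_mem_bivectorOrth (hV : Module.finrank ℝ V = 2 * n + 1)
    (h : ∃ v, wedgePow l w n v ≠ 0) (hhor : LinearMap.range A ≤ LinearMap.ker (functional l))
    {u : X} (hu : A u ∈ bivectorOrth w l (LinearMap.range A)) (v : X) : w ![A u, A v] = 0 := by
  rw [bivectorOrth_eq hV h] at hu
  exact hu.2 _ ⟨⟨v, rfl⟩, hhor ⟨v, rfl⟩⟩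

/-- Linear Lagrangian reduction. -/
theorem formOrth_map_eq_of_reduction (hV : Module.finrank ℝ V = 2 * n + 1)
    (h : ∃ v, wedgePow l w n v ≠ 0) (hhor : LinearMap.range A ≤ LinearMap.ker (functional l))
    (hcoiso : bivectorOrth w l (LinearMap.range A) ≤ LinearMap.range A)
    (hp : Function.Surjective p)
    (hker : LinearMap.ker p = (bivectorOrth w l (LinearMap.range A)).comap A)
    {σ : Y [⋀^Fin 2]→L[ℝ] ℝ} (hσ : ∀ u v, σ ![p u, p v] = w ![A u, A v])
    {C : Submodule ℝ V} (hC : bivectorOrth w l C = C ⊓ LinearMap.ker (functional l))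
    {Z : Submodule ℝ X} (hZ : Z.map A = C ⊓ LinearMap.range A) :
    formOrth σ (Z.map p) = Z.map p := by
  have hmem : ∀ z ∈ Z, A z ∈ C ∧ A z ∈ LinearMap.ker (functional l) := fun z hz => by
    have h1 : A z ∈ C ⊓ LinearMap.range A := hZ ▸ Submodule.mem_map_of_mem hz
    exact ⟨h1.1, hhor h1.2⟩
  apply le_antisymm
  · intro y hy
    obtain ⟨x, rfl⟩ := hp y
    have hx : A x ∈ bivectorOrth w l (C ⊓ LinearMap.range A) := by
      rw [bivectorOrth_eq hV h]
      refine ⟨hhor ⟨x, rfl⟩, ?_⟩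
      rintro c ⟨hc, -⟩
      rw [← hZ] at hc
      obtain ⟨z, hz, rfl⟩ := hc
      rw [contraction_apply, ← hσ]
      exact hy (p z) (Submodule.mem_map_of_mem hz)
    -- Now `A x = u + b` with `u ∈ C ∩ ker λ` and `b ∈ (range A)^{⊥Λ}`. Coisotropy puts `b`, hence
    -- also `u`, in `range A`, so `u` comes from some `z ∈ Z`; and `b` is killed by the projection,
    -- so `p x = p z`.
    rw [bivectorOrth_inf, hC] at hx
    obtain ⟨u, hu, b, hb, hub⟩ := Submodule.mem_sup.1 hx
    have huW : u ∈ LinearMap.range A := by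
      rw [← add_sub_cancel_right u b, hub]
      exact Submodule.sub_mem _ ⟨x, rfl⟩ (hcoiso hb)
    have huZ : u ∈ Z.map A := hZ ▸ ⟨hu.1, huW⟩
    obtain ⟨z, hz, rfl⟩ := huZ
    have hxz : x - z ∈ LinearMap.ker p := by
      rw [hker, Submodule.mem_comap, map_sub, ← hub, add_sub_cancel_left]
      exact hb
    rw [LinearMap.mem_ker, map_sub, sub_eq_zero] at hxz
    exact hxz ▸ Submodule.mem_map_of_mem hz
  · rintro _ ⟨z, hz, rfl⟩ _ ⟨z', hz', rfl⟩
    rw [contraction_apply, hσ]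
    have h1 : A z ∈ bivectorOrth w l C := hC ▸ hmem z hz
    rw [bivectorOrth_eq hV h] at h1
    exact h1.2 _ (hmem z' hz')

theorem bijective_contraction [FiniteDimensional ℝ Y] {σ : Y [⋀^Fin 2]→L[ℝ] ℝ}
    (hσ : Function.Injective (contraction σ)) : Function.Bijective (contraction σ) :=
  ⟨hσ, (LinearMap.injective_iff_surjective_of_finrank_eq_finrank
    (Subspace.dual_finrank_eq).symm).1 hσ⟩

/-- Non-degeneracy identifies `K^{⊥ω}` with the annihilator of `K`. -/
theorem finrank_formOrth [FiniteDimensional ℝ Y] {σ : Y [⋀^Fin 2]→L[ℝ] ℝ}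
    (hσ : Function.Injective (contraction σ)) (K : Submodule ℝ Y) :
    Module.finrank ℝ K + Module.finrank ℝ (formOrth σ K) = Module.finrank ℝ Y := by
  have hbij := bijective_contraction hσ
  have : formOrth σ K =
      K.dualAnnihilator.map (LinearEquiv.ofBijective (contraction σ) hbij).symm.toLinearMap := by
    rw [Submodule.map_equiv_eq_comap_symm]
    ext v
    simp only [Submodule.mem_comap, Submodule.mem_dualAnnihilator]
    rfl
  rw [this, LinearEquiv.finrank_map_eq]
  exact Subspace.finrank_add_finrank_dualAnnihilator_eq K

/-- An isotropic subspace whose dimension is at least that of a Lagrangian one is Lagrangian. -/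
theorem formOrth_eq_of_isotropic [FiniteDimensional ℝ Y] {σ : Y [⋀^Fin 2]→L[ℝ] ℝ}
    (hσ : Function.Injective (contraction σ)) {K K' : Submodule ℝ Y} (hK : formOrth σ K = K)
    (hK' : K' ≤ formOrth σ K') (hdim : Module.finrank ℝ K ≤ Module.finrank ℝ K') :
    formOrth σ K' = K' := by
  have h1 := finrank_formOrth hσ K
  have h2 := finrank_formOrth hσ K'
  rw [hK] at h1
  have h3 := Submodule.finrank_mono hK'
  exact (Submodule.eq_of_le_of_finrank_eq hK' (by omega)).symm

end LinearReduction

end StableHamiltonian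

/-! ### Smooth dependence of pullbacks of alternating maps. -/

section AlternatingSmooth

variable {E F G H : Type*} [NormedAddCommGroup E] [NormedSpace ℝ E] [NormedAddCommGroup F]
  [NormedSpace ℝ F] [NormedAddCommGroup G] [NormedSpace ℝ G] [NormedAddCommGroup H]
  [NormedSpace ℝ H]

/-- The antisymmetrization of multilinear maps, a continuous left inverse of the inclusion of
alternating maps. -/
def ContinuousMultilinearMap.antisymmetrization (k : ℕ) (E G : Type*) [NormedAddCommGroup E]
    [NormedSpace ℝ E] [NormedAddCommGroup G] [NormedSpace ℝ G] :
    ContinuousMultilinearMap ℝ (fun _ : Fin k => E) G →L[ℝ] E [⋀^Fin k]→L[ℝ] G where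
  toFun f := (k.factorial : ℝ)⁻¹ • ContinuousMultilinearMap.alternatization f
  map_add' f g := by rw [map_add, smul_add]
  map_smul' c f := by
    ext v
    simp only [ContinuousAlternatingMap.smul_apply,
      ContinuousMultilinearMap.alternatization_apply_apply, _root_.smul_apply,
      RingHom.id_apply, smul_comm _ c, ← Finset.smul_sum]
  cont := by
    -- Continuity is tested after embedding into multilinear maps, where alternatization is a finite
    -- signed sum of isometries.
    have hc : Continuous (ContinuousMultilinearMap.alternatization :
        ContinuousMultilinearMap ℝ (fun _ : Fin k => E) G →+ E [⋀^Fin k]→L[ℝ] G) := by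
      rw [ContinuousAlternatingMap.isEmbedding_toContinuousMultilinearMap.continuous_iff]
      have : (ContinuousAlternatingMap.toContinuousMultilinearMap ∘
          (ContinuousMultilinearMap.alternatization :
            ContinuousMultilinearMap ℝ (fun _ : Fin k => E) G →+ E [⋀^Fin k]→L[ℝ] G)) =
          fun f => ∑ σ : Equiv.Perm (Fin k), Equiv.Perm.sign σ •
            ContinuousMultilinearMap.domDomCongrₗᵢ ℝ E G σ f := by
        ext f v
        simp [ContinuousMultilinearMap.alternatization_apply_toContinuousMultilinearMap]
        rfl
      rw [this]
      refine continuous_finsetSum _ fun σ _ => ?_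
      exact (LinearIsometryEquiv.continuous _).const_smul _
    exact hc.const_smul (k.factorial : ℝ)⁻¹

theorem ContinuousMultilinearMap.antisymmetrization_toContinuousMultilinearMap {k : ℕ}
    (f : E [⋀^Fin k]→L[ℝ] G) :
    ContinuousMultilinearMap.antisymmetrization k E G f.toContinuousMultilinearMap = f := by
  ext v
  change (k.factorial : ℝ)⁻¹ •
    ContinuousMultilinearMap.alternatization f.toContinuousMultilinearMap v = _
  rw [ContinuousMultilinearMap.alternatization_apply_apply]
  have : ∀ σ : Equiv.Perm (Fin k),
      Equiv.Perm.sign σ • f.toContinuousMultilinearMap (v ∘ σ) = f v := fun σ => by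
    have := f.toAlternatingMap.map_perm v σ
    change _ • f.toAlternatingMap (v ∘ σ) = f v
    rw [this, smul_smul, Int.units_mul_self, one_smul]
    rfl
  simp only [this, Finset.sum_const, Finset.card_univ, Fintype.card_perm, Fintype.card_fin]
  rw [← Nat.cast_smul_eq_nsmul ℝ, smul_smul, inv_mul_cancel₀ (by positivity), one_smul]

/-- For multilinear maps, precomposition is linear in `f` and continuous multilinear in copies of
`g`, hence smooth. Antisymmetrization is continuous linear and fixes alternating maps, so it carries
this over to them. -/
theorem ContDiffAt.continuousAlternatingMap_compContinuousLinearMap {k : ℕ} {m : WithTop ℕ∞}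
    {f : H → F [⋀^Fin k]→L[ℝ] G} {g : H → E →L[ℝ] F} {x : H} (hf : ContDiffAt ℝ m f x)
    (hg : ContDiffAt ℝ m g x) :
    ContDiffAt ℝ m (fun y => (f y).compContinuousLinearMap (g y)) x := by
  have e : (fun y => (f y).compContinuousLinearMap (g y)) = fun y =>
      ContinuousMultilinearMap.antisymmetrization k E G
        (ContinuousMultilinearMap.compContinuousLinearMapContinuousMultilinear ℝ
          (fun _ : Fin k => E) (fun _ : Fin k => F) G (fun _ => g y)
          (ContinuousAlternatingMap.toContinuousMultilinearMapCLM ℝ (f y))) := by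
    funext y
    rw [← ContinuousMultilinearMap.antisymmetrization_toContinuousMultilinearMap
      ((f y).compContinuousLinearMap (g y))]
    rfl
  rw [e]
  refine (ContinuousLinearMap.contDiff _).contDiffAt.comp x (ContDiffAt.clm_apply ?_ ?_)
  · exact (ContinuousMultilinearMap.contDiff _).contDiffAt.comp x (contDiffAt_pi.2 fun _ => hg)
  · exact (ContinuousLinearMap.contDiff _).contDiffAt.comp x hf

end AlternatingSmooth

namespace StableHamiltonian

/-! ### Pullback, smoothness and exterior derivative of forms on manifolds. -/

section Pullback

variable {d e k : ℕ}
  {M : Type*} [TopologicalSpace M] [ChartedSpace (EuclideanSpace ℝ (Fin d)) M]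
  {N : Type*} [TopologicalSpace N] [ChartedSpace (EuclideanSpace ℝ (Fin e)) N]
  {E : Type*} [NormedAddCommGroup E] [NormedSpace ℝ E]

/-- The pullback of a form along a map from a normed space. -/
def FormField.pullbackVec (α : FormField d M k) (φ : E → M) (y : E) : E [⋀^Fin k]→L[ℝ] ℝ :=
  (α (φ y)).compContinuousLinearMap (mfderiv 𝓘(ℝ, E) (𝓡 d) φ y)

/-- The value of a form at a point, as a form on the model space. -/
def FormField.val (α : FormField d M k) (x : M) :
    EuclideanSpace ℝ (Fin d) [⋀^Fin k]→L[ℝ] ℝ := α x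

theorem FormField.pullbackVec_eq (α : FormField d M k) {φ : E → M} {y : E} {x : M}
    (hx : φ y = x) {D : E →L[ℝ] EuclideanSpace ℝ (Fin d)}
    (hD : HasMFDerivAt 𝓘(ℝ, E) (𝓡 d) φ y D) :
    α.pullbackVec φ y = (α.val x).compContinuousLinearMap D := by
  subst hx
  rw [pullbackVec, hD.mfderiv]
  rfl

/-- Near `y`, `φ` is the inverse chart after the chart expression of `φ`; the chain rule turns the
pullback into one between normed spaces. -/
theorem FormField.pullbackVec_eventuallyEq [IsManifold (𝓡 d) ∞ M] (α : FormField d M k)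
    {φ : E → M} {U : Set E} (hU : IsOpen U) (hφ : ContMDiffOn 𝓘(ℝ, E) (𝓡 d) ∞ φ U) {y : E}
    (hy : y ∈ U) (x : M) (hx : φ y ∈ (chartAt (EuclideanSpace ℝ (Fin d)) x).source) :
    α.pullbackVec φ =ᶠ[𝓝 y] fun z =>
      (α.inChart x (extChartAt (𝓡 d) x (φ z))).compContinuousLinearMap
      (fderiv ℝ (fun z => extChartAt (𝓡 d) x (φ z)) z) := by
  have hcont : ContinuousAt φ y := (hφ.contMDiffAt (hU.mem_nhds hy)).continuousAt
  have hsrc : ∀ᶠ z in 𝓝 y, φ z ∈ (extChartAt (𝓡 d) x).source := by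
    rw [← extChartAt_source (𝓡 d)] at hx
    exact hcont.eventually ((isOpen_extChartAt_source x).mem_nhds hx)
  filter_upwards [hsrc.eventually_nhds, hU.eventually_mem hy] with z hz hzU
  have hz' : φ z ∈ (extChartAt (𝓡 d) x).source := hz.self_of_nhds
  have hφz : MDifferentiableAt 𝓘(ℝ, E) (𝓡 d) φ z :=
    (hφ.contMDiffAt (hU.mem_nhds hzU)).mdifferentiableAt (by simp)
  have h1 : MDifferentiableAt (𝓡 d) 𝓘(ℝ, EuclideanSpace ℝ (Fin d)) (extChartAt (𝓡 d) x) (φ z) :=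
    mdifferentiableAt_extChartAt (by rwa [extChartAt_source] at hz')
  have h2 : MDifferentiableAt 𝓘(ℝ, EuclideanSpace ℝ (Fin d)) (𝓡 d) (extChartAt (𝓡 d) x).symm
      (extChartAt (𝓡 d) x (φ z)) :=
    ((contMDiffOn_extChartAt_symm (n := ∞) x).contMDiffAt
      ((isOpen_extChartAt_target x).mem_nhds
        ((extChartAt (𝓡 d) x).map_source hz'))).mdifferentiableAt
      (by simp)
  have h3 : HasMFDerivAt 𝓘(ℝ, E) 𝓘(ℝ, EuclideanSpace ℝ (Fin d))
      (fun z => extChartAt (𝓡 d) x (φ z)) z (fderiv ℝ (fun z => extChartAt (𝓡 d) x (φ z)) z) :=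
    (mdifferentiableAt_iff_differentiableAt.1 (h1.comp z hφz)).hasFDerivAt.hasMFDerivAt
  have h4 := (h2.hasMFDerivAt.comp z h3).congr_of_eventuallyEq (f₁ := φ) (by
    filter_upwards [hz] with z' hz'
    exact ((extChartAt (𝓡 d) x).left_inv hz').symm)
  rw [α.pullbackVec_eq ((extChartAt (𝓡 d) x).left_inv hz').symm h4]
  rfl

theorem FormField.contDiffAt_pullbackVec [IsManifold (𝓡 d) ∞ M] {α : FormField d M k}
    (hα : α.IsSmooth) {φ : E → M} {U : Set E} (hU : IsOpen U)
    (hφ : ContMDiffOn 𝓘(ℝ, E) (𝓡 d) ∞ φ U) {y : E} (hy : y ∈ U) :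
    ContDiffAt ℝ ∞ (α.pullbackVec φ) y := by
  have hx := mem_chart_source (EuclideanSpace ℝ (Fin d)) (φ y)
  refine ContDiffAt.congr_of_eventuallyEq ?_ (α.pullbackVec_eventuallyEq hU hφ hy (φ y) hx)
  have hg : ContDiffAt ℝ ∞ (fun z => extChartAt (𝓡 d) (φ y) (φ z)) y := by
    rw [← contMDiffAt_iff_contDiffAt]
    exact (contMDiffAt_extChartAt (I := 𝓡 d) (n := ∞) (x := φ y)).comp y
      (hφ.contMDiffAt (hU.mem_nhds hy))
  refine ContDiffAt.continuousAlternatingMap_compContinuousLinearMap ?_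
    (hg.fderiv_right (by simp))
  exact ((hα (φ y)).contDiffAt ((isOpen_extChartAt_target (φ y)).mem_nhds
    (mem_extChartAt_target (φ y)))).comp y hg

/-- Naturality of `d`, reduced to normed spaces in the chart around `φ y`, which is the chart
defining `extD` at that point. -/
theorem FormField.extDeriv_pullbackVec [IsManifold (𝓡 d) ∞ M] {α : FormField d M k}
    (hα : α.IsSmooth) {φ : E → M} {U : Set E} (hU : IsOpen U)
    (hφ : ContMDiffOn 𝓘(ℝ, E) (𝓡 d) ∞ φ U) {y : E} (hy : y ∈ U) :
    extDeriv (α.pullbackVec φ) y = (α.extD).pullbackVec φ y := by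
  have hx := mem_chart_source (EuclideanSpace ℝ (Fin d)) (φ y)
  rw [(α.pullbackVec_eventuallyEq hU hφ hy (φ y) hx).extDeriv_eq]
  have hg : ContDiffAt ℝ ∞ (fun z => extChartAt (𝓡 d) (φ y) (φ z)) y := by
    rw [← contMDiffAt_iff_contDiffAt]
    exact (contMDiffAt_extChartAt (I := 𝓡 d) (n := ∞) (x := φ y)).comp y
      (hφ.contMDiffAt (hU.mem_nhds hy))
  rw [extDeriv_pullback (r := ∞) (f := fun z => extChartAt (𝓡 d) (φ y) (φ z)) _ hg
    (by rw [minSmoothness_of_isRCLikeNormedField]; exact WithTop.coe_le_coe.2 le_top)]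
  · have h1 : MDifferentiableAt (𝓡 d) 𝓘(ℝ, EuclideanSpace ℝ (Fin d)) (extChartAt (𝓡 d) (φ y))
        (φ y) := mdifferentiableAt_extChartAt hx
    have h2 : MDifferentiableAt 𝓘(ℝ, E) (𝓡 d) φ y :=
      (hφ.contMDiffAt (hU.mem_nhds hy)).mdifferentiableAt (by simp)
    have h3 : fderiv ℝ (fun z => extChartAt (𝓡 d) (φ y) (φ z)) y =
        (mfderiv (𝓡 d) 𝓘(ℝ, EuclideanSpace ℝ (Fin d)) (extChartAt (𝓡 d) (φ y)) (φ y)).comp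
          (mfderiv 𝓘(ℝ, E) (𝓡 d) φ y) := by
      rw [← mfderiv_eq_fderiv]
      exact mfderiv_comp y h1 h2
    rw [h3]
    rfl
  · exact ((hα (φ y)).contDiffAt ((isOpen_extChartAt_target (φ y)).mem_nhds
      (mem_extChartAt_target (φ y)))).differentiableAt (by simp)

/-- If `β` is, near `x`, the pullback of `α` along `σ`, then the coordinate expressions of `β` near
`x` are the pullbacks of `α`. -/
theorem FormField.inChart_eventuallyEq [IsManifold (𝓡 d) ∞ M] [IsManifold (𝓡 e) ∞ N]
    {α : FormField d M k}
    {β : FormField e N k} {U : Set N} (hU : IsOpen U) {σ : N → M}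
    (hσ : ContMDiffOn (𝓡 e) (𝓡 d) ∞ σ U) (hβ : ∀ q ∈ U, β q = α.pullback σ q) (q : N)
    {y : EuclideanSpace ℝ (Fin e)} (hy : y ∈ (extChartAt (𝓡 e) q).target)
    (hyU : (extChartAt (𝓡 e) q).symm y ∈ U) :
    ∃ U' : Set (EuclideanSpace ℝ (Fin e)), IsOpen U' ∧ y ∈ U' ∧
      ContMDiffOn 𝓘(ℝ, EuclideanSpace ℝ (Fin e)) (𝓡 d) ∞ (σ ∘ (extChartAt (𝓡 e) q).symm) U' ∧
      ∀ z ∈ U', β.inChart q z = α.pullbackVec (σ ∘ (extChartAt (𝓡 e) q).symm) z := by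
  have hsymm := contMDiffOn_extChartAt_symm (I := 𝓡 e) (n := ∞) q
  refine ⟨(extChartAt (𝓡 e) q).target ∩ (extChartAt (𝓡 e) q).symm ⁻¹' U,
    (continuousOn_extChartAt_symm q).isOpen_inter_preimage (isOpen_extChartAt_target q) hU,
    ⟨hy, hyU⟩, hσ.comp (hsymm.mono inter_subset_left) inter_subset_right, ?_⟩
  rintro z ⟨hz, hzU⟩
  have h1 : MDifferentiableAt (𝓡 e) (𝓡 d) σ ((extChartAt (𝓡 e) q).symm z) :=
    (hσ.contMDiffAt (hU.mem_nhds hzU)).mdifferentiableAt (by simp)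
  have h2 : MDifferentiableAt 𝓘(ℝ, EuclideanSpace ℝ (Fin e)) (𝓡 e) (extChartAt (𝓡 e) q).symm z :=
    (hsymm.contMDiffAt ((isOpen_extChartAt_target q).mem_nhds hz)).mdifferentiableAt (by simp)
  rw [α.pullbackVec_eq rfl (h1.hasMFDerivAt.comp z h2.hasMFDerivAt), inChart, hβ _ hzU]
  rfl

/-- The form on the leaf space is reached through this lemma and
`FormField.extD_eq_zero_of_pullback`: it is locally a pullback along sections of `π`, with a section
that varies from point to point. -/
theorem FormField.isSmooth_of_locally_pullback [IsManifold (𝓡 d) ∞ M] [IsManifold (𝓡 e) ∞ N]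
    {α : FormField d M k}
    (hα : α.IsSmooth) {β : FormField e N k}
    (h : ∀ q : N, ∃ U : Set N, IsOpen U ∧ q ∈ U ∧ ∃ σ : N → M,
      ContMDiffOn (𝓡 e) (𝓡 d) ∞ σ U ∧ ∀ q ∈ U, β q = α.pullback σ q) : β.IsSmooth := by
  intro q y hy
  obtain ⟨U, hU, hqU, σ, hσ, hβ⟩ := h ((extChartAt (𝓡 e) q).symm y)
  obtain ⟨U', hU', hyU', hc, he⟩ := inChart_eventuallyEq hU hσ hβ q hy hqU
  exact ((FormField.contDiffAt_pullbackVec hα hU' hc hyU').congr_of_eventuallyEq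
    (Filter.eventuallyEq_of_mem (hU'.mem_nhds hyU') he)).contDiffWithinAt

theorem FormField.extD_eq_zero_of_pullback [IsManifold (𝓡 d) ∞ M] [IsManifold (𝓡 e) ∞ N]
    {α : FormField d M k}
    (hα : α.IsSmooth) (hclosed : ∀ x, α.extD x = 0) {β : FormField e N k} {q : N}
    {U : Set N} (hU : IsOpen U) (hqU : q ∈ U) {σ : N → M}
    (hσ : ContMDiffOn (𝓡 e) (𝓡 d) ∞ σ U) (hβ : ∀ q ∈ U, β q = α.pullback σ q) :
    β.extD q = 0 := by
  obtain ⟨U', hU', hyU', hc, he⟩ := inChart_eventuallyEq hU hσ hβ q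
    (mem_extChartAt_target q) (by rwa [extChartAt_to_inv])
  have h0 : extDeriv (β.inChart q) (extChartAt (𝓡 e) q q) = 0 := by
    rw [(Filter.eventuallyEq_of_mem (hU'.mem_nhds hyU') he).extDeriv_eq,
      FormField.extDeriv_pullbackVec hα hU' hc hyU', pullbackVec, hclosed]
    rfl
  rw [extD, h0]
  rfl

theorem FormField.IsSmooth.pullback [IsManifold (𝓡 d) ∞ M] [IsManifold (𝓡 e) ∞ N]
    {α : FormField d M k} (hα : α.IsSmooth) {f : N → M} (hf : ContMDiff (𝓡 e) (𝓡 d) ∞ f) :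
    (α.pullback f : FormField e N k).IsSmooth :=
  FormField.isSmooth_of_locally_pullback hα fun _ =>
    ⟨univ, isOpen_univ, mem_univ _, f, hf.contMDiffOn, fun _ _ => rfl⟩

theorem FormField.extD_pullback_eq_zero [IsManifold (𝓡 d) ∞ M] [IsManifold (𝓡 e) ∞ N]
    {α : FormField d M k} (hα : α.IsSmooth) (hclosed : ∀ x, α.extD x = 0)
    {f : N → M} (hf : ContMDiff (𝓡 e) (𝓡 d) ∞ f) (x : N) :
    (α.pullback f : FormField e N k).extD x = 0 :=
  FormField.extD_eq_zero_of_pullback hα hclosed isOpen_univ (mem_univ x) hf.contMDiffOn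
    fun _ _ => rfl

end Pullback

/-! ### Normal forms of submersions and immersions. -/

section NormalForms

variable {d k m r : ℕ}
  {N : Type*} [TopologicalSpace N] [ChartedSpace (EuclideanSpace ℝ (Fin k)) N]
  {Q : Type*} [TopologicalSpace Q] [ChartedSpace (EuclideanSpace ℝ (Fin m)) Q]
  {F : Type*} [NormedAddCommGroup F] [NormedSpace ℝ F]

/-- Coordinates `φ` on `N` and `ψ` on `Q` in which `π` is the projection `(a, b) ↦ a`. -/
structure IsAdaptedChart (π : N → Q)
    (φ : OpenPartialHomeomorph N (EuclideanSpace ℝ (Fin m) × F))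
    (ψ : OpenPartialHomeomorph Q (EuclideanSpace ℝ (Fin m))) : Prop where
  contMDiffOn_left : ContMDiffOn (𝓡 k) 𝓘(ℝ, EuclideanSpace ℝ (Fin m) × F) ∞ φ φ.source
  contMDiffOn_left_symm : ContMDiffOn 𝓘(ℝ, EuclideanSpace ℝ (Fin m) × F) (𝓡 k) ∞ φ.symm φ.target
  contMDiffOn_right : ContMDiffOn (𝓡 m) (𝓡 m) ∞ ψ ψ.source
  contMDiffOn_right_symm : ContMDiffOn (𝓡 m) (𝓡 m) ∞ ψ.symm ψ.target
  mapsTo : MapsTo π φ.source ψ.source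
  fst_eq : ∀ x ∈ φ.source, (φ x).1 = ψ (π x)

/-- The normal form of a submersion, with the domain shrunk so that the image is a ball for the
maximum norm of the product. Such a ball is a product of balls, so each fibre appears in it as a
connected slice. -/
theorem exists_isAdaptedChart {π : N → Q} (hπ : Manifold.IsSubmersion (𝓡 k) (𝓡 m) ∞ π) (x : N) :
    ∃ (F : Type) (_ : NormedAddCommGroup F) (_ : NormedSpace ℝ F),
      Nonempty (EuclideanSpace ℝ (Fin k) ≃L[ℝ] EuclideanSpace ℝ (Fin m) × F) ∧
      ∃ (φ : OpenPartialHomeomorph N (EuclideanSpace ℝ (Fin m) × F))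
        (ψ : OpenPartialHomeomorph Q (EuclideanSpace ℝ (Fin m))),
        IsAdaptedChart (k := k) π φ ψ ∧ x ∈ φ.source ∧
          ∃ ρ > 0, φ.target = Metric.ball (φ x) ρ := by
  have h := (hπ.isSubmersionAt x).isSubmersionAtOfComplement_complement
  obtain ⟨χ, ψ, e, hχx, hχ, hψ, hmaps, hloc⟩ : ∃ (χ : OpenPartialHomeomorph N _)
      (ψ : OpenPartialHomeomorph Q _)
      (e : EuclideanSpace ℝ (Fin k) ≃L[ℝ]
        EuclideanSpace ℝ (Fin m) × (hπ.isSubmersionAt x).complement), x ∈ χ.source ∧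
        χ ∈ IsManifold.maximalAtlas (𝓡 k) ∞ N ∧ ψ ∈ IsManifold.maximalAtlas (𝓡 m) ∞ Q ∧
        MapsTo π χ.source ψ.source ∧
        EqOn ((ψ.extend (𝓡 m)) ∘ π ∘ (χ.extend (𝓡 k)).symm) (Prod.fst ∘ e)
          (χ.extend (𝓡 k)).target :=
    ⟨h.domChart, h.codChart, h.equiv, h.mem_domChart_source,
      h.domChart_mem_maximalAtlas, h.codChart_mem_maximalAtlas,
      h.mapsto_domChart_source_codChart_source, h.writtenInCharts⟩
  refine ⟨(hπ.isSubmersionAt x).complement, inferInstance, inferInstance, ⟨e⟩, ?_⟩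
  clear h
  let φ₀ := χ.trans e.toHomeomorph.toOpenPartialHomeomorph
  have hφ₀s : φ₀.source = χ.source := by simp [φ₀]
  have hx₀ : x ∈ φ₀.source := by rwa [hφ₀s]
  obtain ⟨ρ, hρ, hball⟩ := Metric.isOpen_iff.1 φ₀.open_target (φ₀ x) (φ₀.map_source hx₀)
  let φ := (φ₀.symm.restrOpen (Metric.ball (φ₀ x) ρ) Metric.isOpen_ball).symm
  have hφt : φ.target = Metric.ball (φ₀ x) ρ := by
    change φ₀.target ∩ Metric.ball (φ₀ x) ρ = _
    exact inter_eq_right.2 hball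
  have hφs : φ.source ⊆ χ.source := by
    rw [← hφ₀s]
    intro z hz
    have h1 := φ.map_source hz
    rw [hφt] at h1
    have h2 := φ₀.map_target (hball h1)
    have h3 : φ₀.symm (φ z) = z := φ.left_inv hz
    rwa [h3] at h2
  have hfst : ∀ z ∈ χ.source, (e (χ z)).1 = ψ (π z) := fun z hz => by
    have h1 := hloc (x := χ.extend (𝓡 k) z)
      ((χ.extend (𝓡 k)).map_source (by rwa [OpenPartialHomeomorph.extend_source]))
    simp only [Function.comp_apply] at h1
    rw [OpenPartialHomeomorph.extend_left_inv _ hz] at h1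
    exact h1.symm
  have hfun : (φ : N → _) = fun z => e (χ z) := rfl
  have hfunsymm : (φ.symm : _ → N) = fun z => χ.symm (e.symm z) := rfl
  refine ⟨φ, ψ, ⟨?_, ?_,
    contMDiffOn_of_mem_maximalAtlas hψ,
    contMDiffOn_symm_of_mem_maximalAtlas hψ, fun z hz =>
      hmaps (hφs hz), fun z hz => hfst z (hφs hz)⟩, ?_,
      ρ, hρ, hφt⟩
  · rw [hfun]
    exact e.contDiff.contMDiff.comp_contMDiffOn
      ((contMDiffOn_of_mem_maximalAtlas hχ).mono hφs)
  · rw [hfunsymm]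
    refine (contMDiffOn_symm_of_mem_maximalAtlas hχ).comp
      e.symm.contDiff.contMDiff.contMDiffOn ?_
    intro z hz
    have h1 : z ∈ φ₀.target := hball (hφt ▸ hz)
    simpa [φ₀] using h1
  · have h1 : φ₀ x ∈ φ.target := by rw [hφt]; exact Metric.mem_ball_self hρ
    have h2 := φ.map_target h1
    have h3 : φ.symm (φ₀ x) = x := φ₀.left_inv hx₀
    rwa [h3] at h2

/-- A submersion has a smooth local section through every point. -/
theorem exists_local_section {π : N → Q}
    (hπ : Manifold.IsSubmersion (𝓡 k) (𝓡 m) ∞ π) (x : N) :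
    ∃ U : Set Q, IsOpen U ∧ π x ∈ U ∧ ∃ σ : Q → N, ContMDiffOn (𝓡 m) (𝓡 k) ∞ σ U ∧
      σ (π x) = x ∧ ∀ q ∈ U, π (σ q) = q := by
  obtain ⟨F, _, _, -, φ, ψ, h, hx, -⟩ := exists_isAdaptedChart hπ x
  let c : Q → EuclideanSpace ℝ (Fin m) × F := fun q => (ψ q, (φ x).2)
  have hc : ContMDiffOn (𝓡 m) 𝓘(ℝ, EuclideanSpace ℝ (Fin m) × F) ∞ c ψ.source :=
    h.contMDiffOn_right.prodMk_space contMDiffOn_const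
  have hcx : c (π x) = φ x := Prod.ext (h.fst_eq x hx).symm rfl
  refine ⟨ψ.source ∩ c ⁻¹' φ.target, hc.continuousOn.isOpen_inter_preimage ψ.open_source
    φ.open_target, ⟨h.mapsTo hx, ?_⟩, φ.symm ∘ c, ?_, ?_, ?_⟩
  · rw [mem_preimage, hcx]
    exact φ.map_source hx
  · exact h.contMDiffOn_left_symm.comp (hc.mono inter_subset_left) inter_subset_right
  · rw [Function.comp_apply, hcx, φ.left_inv hx]
  · rintro q ⟨hq, hcq⟩
    have h1 := φ.map_target hcq
    refine ψ.injOn (h.mapsTo h1) hq ?_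
    have h2 := h.fst_eq _ h1
    rw [φ.right_inv hcq] at h2
    exact h2.symm

/-- Differentiate `π ∘ σ = id` for a local section `σ` through `x`. -/
theorem mfderiv_surjective_of_isSubmersion {π : N → Q}
    (hπ : Manifold.IsSubmersion (𝓡 k) (𝓡 m) ∞ π) (x : N) :
    Function.Surjective (mfderiv (𝓡 k) (𝓡 m) π x) := by
  obtain ⟨U, hU, hxU, σ, hσ, hσx, hsec⟩ := exists_local_section hπ x
  have h1 : MDifferentiableAt (𝓡 m) (𝓡 k) σ (π x) :=
    (hσ.contMDiffAt (hU.mem_nhds hxU)).mdifferentiableAt (by simp)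
  have h2 : HasMFDerivAt (𝓡 k) (𝓡 m) π (σ (π x)) (mfderiv (𝓡 k) (𝓡 m) π x) := by
    rw [hσx]
    exact ((hπ.contMDiff x).mdifferentiableAt (by simp)).hasMFDerivAt
  have h3 := (h2.comp (π x) h1.hasMFDerivAt).congr_of_eventuallyEq (f₁ := id)
    (by filter_upwards [hU.mem_nhds hxU] with q hq using (hsec q hq).symm)
  have h4 := hasMFDerivAt_unique h3 (hasMFDerivAt_id (π x))
  intro v
  exact ⟨mfderiv (𝓡 m) (𝓡 k) σ (π x) v, DFunLike.congr_fun h4 v⟩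

/-- The normal form of an immersion provides a differentiable local left inverse `g`; differentiate
`g ∘ j = id`. -/
theorem mfderiv_injective_of_isImmersion {j : N → Q}
    (hj : Manifold.IsImmersion (𝓡 k) (𝓡 m) ∞ j) (x : N) :
    Function.Injective (mfderiv (𝓡 k) (𝓡 m) j x) := by
  have h := (hj.isImmersionAt x).isImmersionAtOfComplement_complement
  obtain ⟨φ, ψ, e, hx, hfx, hφ, hψ, hloc⟩ : ∃ (φ : OpenPartialHomeomorph N _)
      (ψ : OpenPartialHomeomorph Q _)
      (e : (EuclideanSpace ℝ (Fin k) × (hj.isImmersionAt x).complement) ≃L[ℝ]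
        EuclideanSpace ℝ (Fin m)), x ∈ φ.source ∧ j x ∈ ψ.source ∧
        φ ∈ IsManifold.maximalAtlas (𝓡 k) ∞ N ∧ ψ ∈ IsManifold.maximalAtlas (𝓡 m) ∞ Q ∧
        EqOn ((ψ.extend (𝓡 m)) ∘ j ∘ (φ.extend (𝓡 k)).symm) (e ∘ (·, 0))
          (φ.extend (𝓡 k)).target :=
    ⟨h.domChart, h.codChart, h.equiv, h.mem_domChart_source, h.mem_codChart_source,
      h.domChart_mem_maximalAtlas, h.codChart_mem_maximalAtlas, h.writtenInCharts⟩
  have hval : ∀ z ∈ φ.source, e.symm (ψ (j z)) = (φ z, 0) := fun z hz => by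
    have h1 := hloc (x := φ.extend (𝓡 k) z)
      ((φ.extend (𝓡 k)).map_source (by rwa [OpenPartialHomeomorph.extend_source]))
    simp only [Function.comp_apply] at h1
    rw [OpenPartialHomeomorph.extend_left_inv _ hz] at h1
    exact e.symm_apply_eq.2 h1
  let g : Q → N := fun q => φ.symm (e.symm (ψ q)).1
  have hinv : ∀ z ∈ φ.source, g (j z) = z := fun z hz => by
    simp only [g]
    rw [hval z hz, φ.left_inv hz]
  have hg : MDifferentiableAt (𝓡 m) (𝓡 k) g (j x) := by
    have h1 : ContMDiffAt (𝓡 m) (𝓡 m) ∞ ψ (j x) :=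
      (contMDiffOn_of_mem_maximalAtlas hψ).contMDiffAt (ψ.open_source.mem_nhds hfx)
    have h2 : ContMDiffAt (𝓡 m) (𝓡 k) ∞ (fun q => (e.symm (ψ q)).1) (j x) :=
      (contDiff_fst.comp e.symm.contDiff).contMDiff.contMDiffAt.comp (j x) h1
    have h3 : ContMDiffAt (𝓡 k) (𝓡 k) ∞ φ.symm (e.symm (ψ (j x))).1 := by
      rw [hval x hx]
      exact (contMDiffOn_symm_of_mem_maximalAtlas hφ).contMDiffAt
        (φ.open_target.mem_nhds (φ.map_source hx))
    exact (h3.comp (j x) h2).mdifferentiableAt (by simp)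
  have h1 : MDifferentiableAt (𝓡 k) (𝓡 m) j x := (hj.contMDiff x).mdifferentiableAt (by simp)
  have h3 := (hg.hasMFDerivAt.comp x h1.hasMFDerivAt).congr_of_eventuallyEq (f₁ := id)
    (by filter_upwards [φ.open_source.mem_nhds hx] with z hz using (hinv z hz).symm)
  have h4 := hasMFDerivAt_unique h3 (hasMFDerivAt_id x)
  intro u v huv
  have hu := DFunLike.congr_fun h4 u
  have hv := DFunLike.congr_fun h4 v
  exact hu.symm.trans ((congrArg (mfderiv (𝓡 m) (𝓡 k) g (j x)) huv).trans hv)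

end NormalForms

/-! ### Dimension bounds from Hausdorff dimension. -/

section Dimension

/-- A smooth map from a second countable `r`-dimensional manifold whose image is a neighbourhood of
a point takes values in a space of dimension at most `r`. -/
theorem finrank_le_of_image_mem_nhds {r : ℕ} {X : Type*} [TopologicalSpace X]
    [SecondCountableTopology X] [ChartedSpace (EuclideanSpace ℝ (Fin r)) X]
    [IsManifold (𝓡 r) ∞ X] {E : Type*} [NormedAddCommGroup E] [NormedSpace ℝ E]
    [FiniteDimensional ℝ E] {f : X → E} {U : Set X} (hU : IsOpen U)
    (hf : ContMDiffOn (𝓡 r) 𝓘(ℝ, E) ∞ f U) {y : E} (hy : f '' U ∈ 𝓝 y) :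
    Module.finrank ℝ E ≤ r := by
  -- Countably many charts suffice. On each, `f` is locally Lipschitz and so has image of Hausdorff
  -- dimension at most `r`, while a neighbourhood of a point of `E` has Hausdorff dimension `dim E`.
  obtain ⟨s, hs, hcover⟩ := TopologicalSpace.countable_cover_nhds
    (fun x : X => extChartAt_source_mem_nhds (I := 𝓡 r) x)
  let T : X → Set (EuclideanSpace ℝ (Fin r)) := fun x =>
    (extChartAt (𝓡 r) x).target ∩ (extChartAt (𝓡 r) x).symm ⁻¹' U
  have hT : ∀ x, IsOpen (T x) := fun x =>
    (continuousOn_extChartAt_symm x).isOpen_inter_preimage (isOpen_extChartAt_target x) hU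
  have hsub : f '' U ⊆ ⋃ x ∈ s, (f ∘ (extChartAt (𝓡 r) x).symm) '' T x := by
    rintro _ ⟨z, hz, rfl⟩
    have hzu : z ∈ ⋃ x ∈ s, (extChartAt (𝓡 r) x).source := hcover ▸ mem_univ z
    obtain ⟨x, hxs, hzx⟩ := mem_iUnion₂.1 hzu
    refine mem_iUnion₂.2 ⟨x, hxs, extChartAt (𝓡 r) x z,
      ⟨(extChartAt (𝓡 r) x).map_source hzx, ?_⟩, ?_⟩
    · rwa [mem_preimage, (extChartAt (𝓡 r) x).left_inv hzx]
    · rw [Function.comp_apply, (extChartAt (𝓡 r) x).left_inv hzx]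
  have hdim : ∀ x, dimH ((f ∘ (extChartAt (𝓡 r) x).symm) '' T x) ≤ r := fun x => by
    have hfx : ContDiffOn ℝ ∞ (f ∘ (extChartAt (𝓡 r) x).symm) (T x) := by
      rw [← contMDiffOn_iff_contDiffOn]
      exact hf.comp ((contMDiffOn_extChartAt_symm (n := ∞) x).mono inter_subset_left)
        inter_subset_right
    calc dimH ((f ∘ (extChartAt (𝓡 r) x).symm) '' T x) ≤ dimH (T x) := by
          refine dimH_image_le_of_locally_lipschitzOn fun z hz => ?_
          obtain ⟨K, t, ht, hK⟩ :=
            (((hfx.contDiffAt ((hT x).mem_nhds hz)).of_le (by simp)).exists_lipschitzOnWith :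
              ∃ K, ∃ t ∈ 𝓝 z, LipschitzOnWith K (f ∘ (extChartAt (𝓡 r) x).symm) t)
          exact ⟨K, t, mem_nhdsWithin_of_mem_nhds ht, hK⟩
      _ ≤ dimH (univ : Set (EuclideanSpace ℝ (Fin r))) := dimH_mono (subset_univ _)
      _ = r := by rw [Real.dimH_univ_eq_finrank, finrank_euclideanSpace_fin]
  have h1 : (Module.finrank ℝ E : ENNReal) ≤ r := by
    rw [← Real.dimH_of_mem_nhds hy]
    refine (dimH_mono hsub).trans ?_
    rw [dimH_bUnion hs]
    exact iSup₂_le fun x _ => hdim x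
  exact_mod_cast h1

end Dimension

/-! ### Projections onto leaf spaces. -/

section LeafProjection

variable {k m : ℕ}
  {N : Type*} [TopologicalSpace N] [ChartedSpace (EuclideanSpace ℝ (Fin k)) N]
  {Q : Type*} {D : ∀ x : N, Submodule ℝ (TangentSpace (𝓡 k) x)} {π : N → Q}

theorem IsLeafProjection.isConnectedIntegralManifold (hleaf : IsLeafProjection D π) (q : Q) :
    IsConnectedIntegralManifold D (π ⁻¹' {q}) := by
  have h : π ⁻¹' {q} ∈ {A : Set N | IsLeaf D A} := hleaf ▸ ⟨q, rfl⟩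
  exact h.prop

theorem IsLeafProjection.surjective (hleaf : IsLeafProjection D π) : Function.Surjective π := by
  intro q
  obtain ⟨r, F, _, _, j, _, _, _, _, _, _, hr⟩ := hleaf.isConnectedIntegralManifold q
  obtain ⟨p⟩ : Nonempty F := inferInstance
  have : j p ∈ π ⁻¹' {q} := hr ▸ mem_range_self p
  exact ⟨j p, this⟩

/-- A function on the total space which is locally constant along the fibres is constant on the
fibres, as the leaves are connected. -/
theorem IsLeafProjection.eq_of_locally_eq {Y : Type*} (hleaf : IsLeafProjection D π) {f : N → Y}
    (hf : ∀ x, ∀ᶠ z in 𝓝 x, π z = π x → f z = f x) {x x' : N} (h : π x = π x') : f x = f x' := by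
  obtain ⟨r, F, _, _, j, _, _, _, _, hj, _, hr⟩ := hleaf.isConnectedIntegralManifold (π x')
  have hπj : ∀ p, π (j p) = π x' := fun p => by
    have : j p ∈ π ⁻¹' {π x'} := hr ▸ mem_range_self p
    exact this
  -- The leaf topology may be finer than the one induced from `N`; only continuity of `j` is needed
  -- to transfer local constancy.
  have hc : IsLocallyConstant (f ∘ j) := by
    rw [IsLocallyConstant.iff_eventually_eq]
    intro p
    filter_upwards [(hj.immersion.contMDiff.continuous.tendsto p).eventually (hf (j p))]
      with p' hp'
    exact hp' ((hπj p').trans (hπj p).symm)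
  obtain ⟨p, hp⟩ : x ∈ range j := hr ▸ h
  obtain ⟨p', hp'⟩ : x' ∈ range j := hr ▸ rfl
  have := hc.apply_eq_of_preconnectedSpace p p'
  rwa [Function.comp_apply, Function.comp_apply, hp, hp'] at this

variable [TopologicalSpace Q] [ChartedSpace (EuclideanSpace ℝ (Fin m)) Q]

/-- Since `π` is constant on the leaf, `D x ⊆ ker dπ`. Equality is a matter of dimension: the leaf
must fill a whole slice of the fibre, of dimension `k - m`, and a second countable manifold of
smaller dimension cannot do so. -/
theorem IsLeafProjection.ker_mfderiv_eq (hleaf : IsLeafProjection D π)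
    (hπ : Manifold.IsSubmersion (𝓡 k) (𝓡 m) ∞ π) (x : N) :
    LinearMap.ker (mfderiv (𝓡 k) (𝓡 m) π x).toLinearMap = D x := by
  obtain ⟨r, F, _, _, j, _, _, _, _, hj, hD, hr⟩ := hleaf.isConnectedIntegralManifold (π x)
  have hπj : ∀ p, π (j p) = π x := fun p => by
    have : j p ∈ π ⁻¹' {π x} := hr ▸ mem_range_self p
    exact this
  obtain ⟨p, rfl⟩ : x ∈ range j := hr ▸ rfl
  have hsurj := mfderiv_surjective_of_isSubmersion hπ (j p)
  have hdj : MDifferentiableAt (𝓡 r) (𝓡 k) j p :=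
    (hj.immersion.contMDiff p).mdifferentiableAt (by simp)
  have hdπ : MDifferentiableAt (𝓡 k) (𝓡 m) π (j p) :=
    (hπ.contMDiff (j p)).mdifferentiableAt (by simp)
  have hle : D (j p) ≤ LinearMap.ker (mfderiv (𝓡 k) (𝓡 m) π (j p)).toLinearMap := by
    rw [← hD p]
    rintro _ ⟨u, rfl⟩
    have h1 := (hdπ.hasMFDerivAt.comp p hdj.hasMFDerivAt).congr_of_eventuallyEq
      (f₁ := fun _ => π (j p)) (Filter.Eventually.of_forall fun p' => (hπj p').symm)
    exact DFunLike.congr_fun (hasMFDerivAt_unique h1 (hasMFDerivAt_const (π (j p)) p)) u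
  refine (Submodule.eq_of_le_of_finrank_le hle ?_).symm
  have hDr : Module.finrank ℝ (D (j p)) = r := by
    rw [← hD p, tangentImage, LinearMap.finrank_range_of_inj
      (mfderiv_injective_of_isImmersion hj.immersion p)]
    exact finrank_euclideanSpace_fin
  obtain ⟨G, _, _, ⟨e⟩, φ, ψ, h, hx, ρ, hρ, hball⟩ := exists_isAdaptedChart hπ (j p)
  have : FiniteDimensional ℝ G :=
    Module.Finite.of_surjective (LinearMap.snd ℝ (EuclideanSpace ℝ (Fin m)) G ∘ₗ e.toLinearMap)
      (Prod.snd_surjective.comp e.surjective)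
  have hG : m + Module.finrank ℝ G = k := by
    have := e.toLinearEquiv.finrank_eq
    rw [Module.finrank_prod, finrank_euclideanSpace_fin, finrank_euclideanSpace_fin] at this
    exact this.symm
  -- The slice through `j p` lies in a fibre of `π`, hence in the range of `j`; so the second
  -- coordinate of `φ ∘ j` covers a ball of `G`.
  have hGr : Module.finrank ℝ G ≤ r := by
    have hsmooth : ContMDiffOn (𝓡 r) 𝓘(ℝ, G) ∞ (fun p => (φ (j p)).2) (j ⁻¹' φ.source) :=
      contDiff_snd.contMDiff.comp_contMDiffOn
        (h.contMDiffOn_left.comp hj.immersion.contMDiff.contMDiffOn (subset_refl _))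
    refine finrank_le_of_image_mem_nhds
      (φ.open_source.preimage hj.immersion.contMDiff.continuous) hsmooth
      (y := (φ (j p)).2) ?_
    filter_upwards [Metric.ball_mem_nhds _ hρ] with b hb
    have hmem : ((φ (j p)).1, b) ∈ φ.target := by
      rw [hball, Metric.mem_ball, Prod.dist_eq, dist_self]
      exact max_lt hρ hb
    have hsrc := φ.map_target hmem
    have hπb : π (φ.symm ((φ (j p)).1, b)) = π (j p) := by
      refine ψ.injOn (h.mapsTo hsrc) (h.mapsTo hx) ?_
      rw [← h.fst_eq _ hsrc, ← h.fst_eq _ hx, φ.right_inv hmem]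
    obtain ⟨p', hp'⟩ : φ.symm ((φ (j p)).1, b) ∈ range j := hr ▸ hπb
    refine ⟨p', ?_, ?_⟩
    · rw [mem_preimage, hp']
      exact hsrc
    · simp only [hp', φ.right_inv hmem]
  have hrank := LinearMap.finrank_range_add_finrank_ker
    (mfderiv (𝓡 k) (𝓡 m) π (j p)).toLinearMap
  rw [LinearMap.range_eq_top.2 hsurj, finrank_top] at hrank
  have h1 : Module.finrank ℝ (TangentSpace (𝓡 m) (π (j p))) = m := finrank_euclideanSpace_fin
  have h2 : Module.finrank ℝ (TangentSpace (𝓡 k) (j p)) = k := finrank_euclideanSpace_fin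
  rw [h1, h2] at hrank
  rw [hDr]
  omega

end LeafProjection

/-! ### Descent of two-forms along a surjective linear map. -/

section LinearDescent

variable {X Y : Type*} [NormedAddCommGroup X] [NormedSpace ℝ X] [NormedAddCommGroup Y]
  [NormedSpace ℝ Y]

theorem twoForm_ext {w w' : X [⋀^Fin 2]→L[ℝ] ℝ} (h : ∀ u v, w ![u, v] = w' ![u, v]) : w = w' := by
  ext v
  have e : v = ![v 0, v 1] := by ext i; fin_cases i <;> rfl
  rw [e]
  exact h _ _

theorem comp_pair {w : Y [⋀^Fin 2]→L[ℝ] ℝ} (p : X →L[ℝ] Y) (u v : X) :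
    w.compContinuousLinearMap p ![u, v] = w ![p u, p v] := by
  rw [ContinuousAlternatingMap.compContinuousLinearMap_apply]
  congr 1
  ext i; fin_cases i <;> rfl

theorem twoForm_comp_injective {p : X →L[ℝ] Y} (hp : Function.Surjective p)
    {w w' : Y [⋀^Fin 2]→L[ℝ] ℝ}
    (h : w.compContinuousLinearMap p = w'.compContinuousLinearMap p) : w = w' := by
  refine twoForm_ext fun u v => ?_
  obtain ⟨u, rfl⟩ := hp u
  obtain ⟨v, rfl⟩ := hp v
  rw [← comp_pair, h, comp_pair]

/-- A `2`-form which vanishes on the kernel of a surjective map descends along this map. -/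
theorem exists_twoForm_comp_eq [FiniteDimensional ℝ Y] {p : X →L[ℝ] Y}
    (hp : Function.Surjective p) {α : X [⋀^Fin 2]→L[ℝ] ℝ}
    (hk : ∀ u, p u = 0 → ∀ v, α ![u, v] = 0) :
    ∃ w : Y [⋀^Fin 2]→L[ℝ] ℝ, w.compContinuousLinearMap p = α := by
  obtain ⟨s, hs⟩ := p.toLinearMap.exists_rightInverse_of_surjective (LinearMap.range_eq_top.2 hp)
  refine ⟨α.compContinuousLinearMap (LinearMap.toContinuousLinearMap s), twoForm_ext fun u v => ?_⟩
  rw [comp_pair, comp_pair]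
  have hz : ∀ u, p (s (p u) - u) = 0 := fun u => by
    rw [map_sub, sub_eq_zero]
    exact LinearMap.congr_fun hs (p u)
  have h1 : ∀ u v, α ![s (p u), v] = α ![u, v] := fun u v => by
    have h2 := hk _ (hz u) v
    rw [← contraction_apply, map_sub, LinearMap.sub_apply, sub_eq_zero] at h2
    exact h2
  change α ![s (p u), s (p v)] = _
  rw [h1, twoForm_swap, h1, ← twoForm_swap]

end LinearDescent

/-! ### Closed forms that are constant along the fibres of a product. -/

section LocalDescent

variable {E G : Type*} [NormedAddCommGroup E] [NormedSpace ℝ E] [NormedAddCommGroup G]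
  [NormedSpace ℝ G]

/-- If a closed `2`-form contracts to zero with the direction `w` on an open set, then its
derivative in the direction `w` vanishes. -/
theorem fderiv_eq_zero_of_extDeriv_eq_zero {β : E → E [⋀^Fin 2]→L[ℝ] ℝ} {B : Set E}
    (hB : IsOpen B) (hβ : DifferentiableOn ℝ β B) (hd : ∀ p ∈ B, extDeriv β p = 0) {w : E}
    (hw : ∀ p ∈ B, ∀ v, β p ![w, v] = 0) {p : E} (hp : p ∈ B) : fderiv ℝ β p w = 0 := by
  have hdiff : DifferentiableAt ℝ β p := hβ.differentiableAt (hB.mem_nhds hp)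
  have happ : ∀ v : Fin 2 → E, HasFDerivAt (fun q => β q v)
      ((ContinuousAlternatingMap.apply ℝ E ℝ v).comp (fderiv ℝ β p)) p := fun v =>
    (ContinuousAlternatingMap.apply ℝ E ℝ v).hasFDerivAt.comp p hdiff.hasFDerivAt
  have hzero : ∀ v, fderiv ℝ (fun q => β q ![w, v]) p = 0 := fun v =>
    ((hasFDerivAt_const (0 : ℝ) p).congr_of_eventuallyEq
      (by filter_upwards [hB.mem_nhds hp] with q hq using hw q hq v)).fderiv
  refine twoForm_ext fun u v => ?_
  -- In the three-term formula for `dβ(w, u, v)`, the derivatives of `β(w, v)` and `β(w, u)` vanish,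
  -- leaving only the derivative of `β(u, v)` along `w`.
  have h := (Fin.sum_univ_three _).symm.trans ((extDeriv_apply hdiff ![w, u, v]).symm.trans
    (congrArg (fun γ => γ ![w, u, v]) (hd p hp)))
  have e0 : Fin.removeNth (n := 2) 0 ![w, u, v] = ![u, v] := by ext i; fin_cases i <;> rfl
  have e1 : Fin.removeNth (n := 2) 1 ![w, u, v] = ![w, v] := by ext i; fin_cases i <;> rfl
  have e2 : Fin.removeNth (n := 2) 2 ![w, u, v] = ![w, u] := by ext i; fin_cases i <;> rfl
  rw [e0, e1, e2, hzero, hzero, (happ _).fderiv] at h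
  simpa using h

/-- A function on a ball of a product whose derivative vanishes in the directions of the second
factor depends on the first variable only. -/
theorem eq_of_fderiv_inr_eq_zero {Y : Type*} [NormedAddCommGroup Y] [NormedSpace ℝ Y]
    {f : E × G → Y} {c : E × G} {ρ : ℝ} (hf : DifferentiableOn ℝ f (Metric.ball c ρ))
    (hw : ∀ p ∈ Metric.ball c ρ, ∀ g : G, fderiv ℝ f p (0, g) = 0) {a : E} {b b' : G}
    (hb : (a, b) ∈ Metric.ball c ρ) (hb' : (a, b') ∈ Metric.ball c ρ) : f (a, b) = f (a, b') := by
  have hmem : ∀ b'', (a, b'') ∈ Metric.ball c ρ ↔ a ∈ Metric.ball c.1 ρ ∧ b'' ∈ Metric.ball c.2 ρ :=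
    fun b'' => by simp only [Metric.mem_ball, Prod.dist_eq, max_lt_iff]
  have ha : a ∈ Metric.ball c.1 ρ := ((hmem b).1 hb).1
  have hder : ∀ b'' ∈ Metric.ball c.2 ρ, HasFDerivAt (fun b'' : G => f (a, b''))
      ((fderiv ℝ f (a, b'')).comp (ContinuousLinearMap.inr ℝ E G)) b'' := fun b'' hb'' =>
    ((hf.differentiableAt (Metric.isOpen_ball.mem_nhds
      ((hmem b'').2 ⟨ha, hb''⟩))).hasFDerivAt).comp b'' (hasFDerivAt_prodMk_right a b'')
  refine Metric.isOpen_ball.is_const_of_fderiv_eq_zero (f := fun b'' : G => f (a, b''))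
    (convex_ball c.2 ρ).isPreconnected
    (fun b'' hb'' => (hder b'' hb'').differentiableAt.differentiableWithinAt)
    (fun b'' hb'' => ?_) ((hmem b).1 hb).2 ((hmem b').1 hb').2
  rw [(hder b'' hb'').fderiv]
  ext1 g
  exact hw _ ((hmem b'').2 ⟨ha, hb''⟩) g

theorem eq_of_extDeriv_eq_zero {β : E × G → (E × G) [⋀^Fin 2]→L[ℝ] ℝ} {c : E × G} {ρ : ℝ}
    (hβ : DifferentiableOn ℝ β (Metric.ball c ρ)) (hd : ∀ p ∈ Metric.ball c ρ, extDeriv β p = 0)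
    (hw : ∀ p ∈ Metric.ball c ρ, ∀ g : G, ∀ v, β p ![(0, g), v] = 0) {a : E} {b b' : G}
    (hb : (a, b) ∈ Metric.ball c ρ) (hb' : (a, b') ∈ Metric.ball c ρ) : β (a, b) = β (a, b') :=
  eq_of_fderiv_inr_eq_zero hβ (fun _ hp g => fderiv_eq_zero_of_extDeriv_eq_zero Metric.isOpen_ball
    hβ hd (fun p hp => hw p hp g) hp) hb hb'

end LocalDescent

/-! ### Descent of a closed form to the leaf space. -/

section Descent

variable {k m : ℕ}
  {N : Type*} [TopologicalSpace N] [ChartedSpace (EuclideanSpace ℝ (Fin k)) N]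
  [IsManifold (𝓡 k) ∞ N]
  {Q : Type*} [TopologicalSpace Q] [ChartedSpace (EuclideanSpace ℝ (Fin m)) Q]
  {π : N → Q}

/-- The derivative `T_x π`, as a map between the model spaces. -/
def modelDeriv (π : N → Q) (x : N) : EuclideanSpace ℝ (Fin k) →L[ℝ] EuclideanSpace ℝ (Fin m) :=
  mfderiv (𝓡 k) (𝓡 m) π x

/-- In an adapted chart the expression `β` of `α` kills vertical vectors, because `α` comes from
`η`; being closed as well, it is constant along the slice. Equality of `β` at two points of a slice
then gives equality of `η`. -/
theorem descend_locally_eq (hπ : Manifold.IsSubmersion (𝓡 k) (𝓡 m) ∞ π) {α : FormField k N 2}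
    (hα : α.IsSmooth) (hclosed : ∀ x, α.extD x = 0)
    {η : N → EuclideanSpace ℝ (Fin m) [⋀^Fin 2]→L[ℝ] ℝ}
    (hω : ∀ x, (η x).compContinuousLinearMap (modelDeriv π x) = α.val x) (x : N) :
    ∀ᶠ z in 𝓝 x, π z = π x → η z = η x := by
  obtain ⟨G, _, _, -, φ, ψ, h, hx, ρ, hρ, hball⟩ := exists_isAdaptedChart hπ x
  filter_upwards [φ.open_source.mem_nhds hx] with z hz hzx
  let E := EuclideanSpace ℝ (Fin m) × G
  let β : E → E [⋀^Fin 2]→L[ℝ] ℝ := α.pullbackVec φ.symm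
  have hβ : ∀ p ∈ φ.target, ContDiffAt ℝ ∞ β p := fun p hp =>
    FormField.contDiffAt_pullbackVec hα φ.open_target h.contMDiffOn_left_symm hp
  -- Indexing `T` by the first coordinate alone ensures that the same linear map occurs at `z` and
  -- at `x`, so that it can be cancelled at the end.
  obtain ⟨T, hψ⟩ : ∃ T : EuclideanSpace ℝ (Fin m) →
      EuclideanSpace ℝ (Fin m) →L[ℝ] EuclideanSpace ℝ (Fin m), ∀ y ∈ φ.source,
        HasMFDerivAt (𝓡 m) (𝓡 m) ψ.symm (φ y).1 (T (φ y).1) := by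
    refine ⟨fun a => mfderiv (𝓡 m) (𝓡 m) ψ.symm a, fun y hy => ?_⟩
    refine ((h.contMDiffOn_right_symm.contMDiffAt (ψ.open_target.mem_nhds ?_)).mdifferentiableAt
      (by simp)).hasMFDerivAt
    rw [h.fst_eq y hy]
    exact ψ.map_source (h.mapsTo hy)
  -- the coordinate expression in terms of the descended form
  have hβω : ∀ y ∈ φ.source, β (φ y) = (η y).compContinuousLinearMap
      ((T (φ y).1).comp (ContinuousLinearMap.fst ℝ _ G)) := fun y hy => by
    have hp := φ.map_source hy
    have h1 : HasMFDerivAt 𝓘(ℝ, E) (𝓡 k) φ.symm (φ y) (mfderiv 𝓘(ℝ, E) (𝓡 k) φ.symm (φ y)) :=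
      ((h.contMDiffOn_left_symm.contMDiffAt (φ.open_target.mem_nhds hp)).mdifferentiableAt
        (by simp)).hasMFDerivAt
    have h2 : HasMFDerivAt (𝓡 k) (𝓡 m) π (φ.symm (φ y)) (modelDeriv π y) := by
      rw [φ.left_inv hy]
      exact ((hπ.contMDiff y).mdifferentiableAt (by simp)).hasMFDerivAt
    have h3 : HasMFDerivAt 𝓘(ℝ, E) (𝓡 m) (Prod.fst : E → EuclideanSpace ℝ (Fin m)) (φ y)
        (ContinuousLinearMap.fst ℝ (EuclideanSpace ℝ (Fin m)) G) :=
      (ContinuousLinearMap.fst ℝ (EuclideanSpace ℝ (Fin m)) G).hasFDerivAt.hasMFDerivAt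
    have h4 := ((hψ y hy).comp (φ y) h3).congr_of_eventuallyEq (f₁ := π ∘ φ.symm) (by
      filter_upwards [φ.open_target.mem_nhds hp] with p hp
      have hs := φ.map_target hp
      have := h.fst_eq _ hs
      rw [φ.right_inv hp] at this
      rw [Function.comp_apply, Function.comp_apply, this, ψ.left_inv (h.mapsTo hs)])
    have h5 := hasMFDerivAt_unique (h2.comp (φ y) h1) h4
    refine (α.pullbackVec_eq (φ.left_inv hy) h1).trans ?_
    rw [← hω y]
    exact congrArg (fun D => (η y).compContinuousLinearMap D) h5
  have hvert : ∀ p ∈ φ.target, ∀ g : G, ∀ v, β p ![(0, g), v] = 0 := fun p hp g v => by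
    have h1 := hβω _ (φ.map_target hp)
    rw [φ.right_inv hp] at h1
    rw [h1, comp_pair, ← contraction_apply]
    have h2 : ((T p.1).comp (ContinuousLinearMap.fst ℝ _ G)) (0, g) = 0 := map_zero (T p.1)
    rw [h2, map_zero]
    rfl
  have hext : ∀ p ∈ φ.target, extDeriv β p = 0 := fun p hp => by
    refine (FormField.extDeriv_pullbackVec hα φ.open_target h.contMDiffOn_left_symm hp).trans ?_
    rw [FormField.pullbackVec, hclosed]
    rfl
  have hfst : (φ z).1 = (φ x).1 := by rw [h.fst_eq z hz, h.fst_eq x hx, hzx]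
  have heq : β (φ z) = β (φ x) := by
    have hz' := φ.map_source hz
    have hx' := φ.map_source hx
    rw [← Prod.mk.eta (p := φ z), hfst, hball] at hz'
    rw [← Prod.mk.eta (p := φ x), hball] at hx'
    rw [← Prod.mk.eta (p := φ z), hfst, ← Prod.mk.eta (p := φ x)]
    refine eq_of_extDeriv_eq_zero (c := φ x) (ρ := ρ) (fun p hp => ?_) ?_ ?_ hz' hx'
    · exact ((hβ p (hball ▸ hp)).differentiableAt (by simp)).differentiableWithinAt
    · exact fun p hp => hext p (hball ▸ hp)
    · exact fun p hp => hvert p (hball ▸ hp)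
  rw [hβω z hz, hβω x hx, hfst] at heq
  suffices hT : Function.Surjective (T (φ x).1) from
    twoForm_comp_injective (p := (T (φ x).1).comp (ContinuousLinearMap.fst ℝ _ G))
      (hT.comp Prod.fst_surjective) heq
  intro v
  have hπx := h.mapsTo hx
  have h1 : HasMFDerivAt (𝓡 m) (𝓡 m) ψ (π x) (mfderiv (𝓡 m) (𝓡 m) ψ (π x)) :=
    ((h.contMDiffOn_right.contMDiffAt (ψ.open_source.mem_nhds hπx)).mdifferentiableAt
      (by simp)).hasMFDerivAt
  have h2 := hψ x hx
  rw [h.fst_eq x hx] at h2 ⊢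
  have h3 := (h2.comp (π x) h1).congr_of_eventuallyEq (f₁ := id) (by
    filter_upwards [ψ.open_source.mem_nhds hπx] with q hq using (ψ.left_inv hq).symm)
  exact ⟨mfderiv (𝓡 m) (𝓡 m) ψ (π x) v,
    DFunLike.congr_fun (hasMFDerivAt_unique h3 (hasMFDerivAt_id (π x))) v⟩

/-- A closed form on the total space which vanishes on the leaves descends to the leaf space. -/
theorem exists_descended_form [IsManifold (𝓡 m) ∞ Q]
    {D : ∀ x : N, Submodule ℝ (TangentSpace (𝓡 k) x)}
    (hleaf : IsLeafProjection D π)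
    (hπ : Manifold.IsSubmersion (𝓡 k) (𝓡 m) ∞ π) {α : FormField k N 2}
    (hα : α.IsSmooth) (hclosed : ∀ x, α.extD x = 0)
    (hD : ∀ x, ∀ u ∈ D x, ∀ v, α x ![u, v] = 0) :
    ∃ w : FormField m Q 2, w.IsSmooth ∧ (∀ q, w.extD q = 0) ∧
      (w.pullback π : FormField k N 2) = α := by
  have hsurj := mfderiv_surjective_of_isSubmersion hπ
  have hex : ∀ x, ∃ w : EuclideanSpace ℝ (Fin m) [⋀^Fin 2]→L[ℝ] ℝ,
      w.compContinuousLinearMap (modelDeriv π x) = α.val x := fun x =>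
    exists_twoForm_comp_eq (hsurj x) fun u hu v => hD x u (by
      rw [← hleaf.ker_mfderiv_eq hπ x]
      exact hu) v
  choose η hω using hex
  have hconst : ∀ x x', π x = π x' → η x = η x' := fun x x' hxx' =>
    hleaf.eq_of_locally_eq (descend_locally_eq hπ hα hclosed hω) hxx'
  -- By `hconst` the choice of the preimage is immaterial.
  let w : FormField m Q 2 := fun q => η (Function.surjInv hleaf.surjective q)
  have hw : ∀ x, w.val (π x) = η x := fun x =>
    hconst _ _ (Function.surjInv_eq hleaf.surjective (π x))
  -- With `π ∘ σ = id` on `U`, the pullback of `α = π^*w` by `σ` is `w`.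
  have hloc : ∀ q : Q, ∃ U : Set Q, IsOpen U ∧ q ∈ U ∧ ∃ σ : Q → N,
      ContMDiffOn (𝓡 m) (𝓡 k) ∞ σ U ∧ ∀ q ∈ U, w q = α.pullback σ q := fun q => by
    obtain ⟨x, rfl⟩ := hleaf.surjective q
    obtain ⟨U, hU, hxU, σ, hσ, -, hsec⟩ := exists_local_section hπ x
    refine ⟨U, hU, hxU, σ, hσ, fun q hq => ?_⟩
    have h1 : HasMFDerivAt (𝓡 m) (𝓡 k) σ q (mfderiv (𝓡 m) (𝓡 k) σ q) :=
      ((hσ.contMDiffAt (hU.mem_nhds hq)).mdifferentiableAt (by simp)).hasMFDerivAt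
    have h2 : HasMFDerivAt (𝓡 k) (𝓡 m) π (σ q) (modelDeriv π (σ q)) :=
      ((hπ.contMDiff (σ q)).mdifferentiableAt (by simp)).hasMFDerivAt
    have h3 := (h2.comp q h1).congr_of_eventuallyEq (f₁ := id) (by
      filter_upwards [hU.mem_nhds hq] with q' hq' using (hsec q' hq').symm)
    have h4 := hasMFDerivAt_unique h3 (hasMFDerivAt_id q)
    have h5 : w.val q = η (σ q) := by rw [← hw, hsec q hq]
    change w.val q = (α.val (σ q)).compContinuousLinearMap
      (mfderiv (𝓡 m) (𝓡 k) σ q : EuclideanSpace ℝ (Fin m) →L[ℝ] EuclideanSpace ℝ (Fin k))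
    rw [h5, ← hω]
    exact (congrArg (fun D => (η (σ q)).compContinuousLinearMap D) h4).symm
  refine ⟨w, FormField.isSmooth_of_locally_pullback hα hloc, fun q => ?_, ?_⟩
  · obtain ⟨U, hU, hqU, σ, hσ, he⟩ := hloc q
    exact FormField.extD_eq_zero_of_pullback hα hclosed hU hqU hσ he
  · funext x
    change (w.val (π x)).compContinuousLinearMap (modelDeriv π x) = α.val x
    rw [hw, hω]

end Descent

/-! ### The constant rank theorem in normed spaces. -/

section ConstantRank

variable {E Y : Type*} [NormedAddCommGroup E] [NormedSpace ℝ E] [FiniteDimensional ℝ E]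
  [NormedAddCommGroup Y] [NormedSpace ℝ Y]

/-- Constant rank theorem: locally, `g = γ ∘ A ∘ g` with `A` linear and `γ` differentiable with
`range dγ ⊆ range dg`. -/
theorem exists_constant_rank_factorization {g : E → Y} {U : Set E} (hU : IsOpen U)
    (hg : ContDiffOn ℝ 1 g U) {h : ℕ}
    (hrank : ∀ x ∈ U, Module.finrank ℝ (LinearMap.range (fderiv ℝ g x).toLinearMap) = h) {z : E}
    (hz : z ∈ U) :
    ∃ O : Set E, IsOpen O ∧ z ∈ O ∧ O ⊆ U ∧ ∃ (R : Submodule ℝ Y) (A : Y →L[ℝ] R) (γ : R → Y),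
      ∀ x ∈ O, g x = γ (A (g x)) ∧ DifferentiableAt ℝ γ (A (g x)) ∧
        LinearMap.range (fderiv ℝ γ (A (g x))).toLinearMap ≤
          LinearMap.range (fderiv ℝ g x).toLinearMap := by
  have hgd : ∀ x ∈ U, DifferentiableAt ℝ g x := fun x hx =>
    (hg.contDiffAt (hU.mem_nhds hx)).differentiableAt (by simp)
  let R := LinearMap.range (fderiv ℝ g z).toLinearMap
  let K := LinearMap.ker (fderiv ℝ g z).toLinearMap
  obtain ⟨A, hA⟩ := Submodule.ClosedComplemented.of_finiteDimensional (𝕜 := ℝ) R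
  obtain ⟨B, hB⟩ := Submodule.ClosedComplemented.of_finiteDimensional (𝕜 := ℝ) K
  let L : E →L[ℝ] R × K := (A.comp (fderiv ℝ g z)).prod B
  have hL : Function.Injective L.toLinearMap := by
    refine (injective_iff_map_eq_zero _).2 fun v hv => ?_
    have h1 : A (fderiv ℝ g z v) = 0 := congrArg Prod.fst hv
    have h2 : B v = 0 := congrArg Prod.snd hv
    have h3 := hA ⟨fderiv ℝ g z v, ⟨v, rfl⟩⟩
    rw [h1] at h3
    have h4 : fderiv ℝ g z v = 0 := (congrArg Subtype.val h3).symm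
    have h5 := hB ⟨v, h4⟩
    rw [h2] at h5
    exact (congrArg Subtype.val h5).symm
  have hdim : Module.finrank ℝ E = Module.finrank ℝ (R × K) := by
    rw [Module.finrank_prod, LinearMap.finrank_range_add_finrank_ker]
  let e : E ≃L[ℝ] R × K := (LinearEquiv.ofInjectiveOfFinrankEq L.toLinearMap hL
    hdim).toContinuousLinearEquiv
  have he : (e : E →L[ℝ] R × K) = L := by ext v : 1; rfl
  -- The derivative of `Ψ` at `z` is `L`, invertible by rank-nullity, so `Ψ` is a local coordinate
  -- system in which `A ∘ g` is the first projection.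
  let Ψ : E → R × K := fun x => (A (g x), B x)
  have hΨ : ContDiffAt ℝ 1 Ψ z :=
    (A.contDiff.contDiffAt.comp z (hg.contDiffAt (hU.mem_nhds hz))).prodMk B.contDiff.contDiffAt
  have hΨ' : HasFDerivAt Ψ (e : E →L[ℝ] R × K) z := by
    rw [he]
    exact (A.hasFDerivAt.comp z (hgd z hz).hasFDerivAt).prodMk B.hasFDerivAt
  let Θ := hΨ.toOpenPartialHomeomorph Ψ hΨ' one_ne_zero
  have hzΘ : z ∈ Θ.source := hΨ.mem_toOpenPartialHomeomorph_source hΨ' one_ne_zero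
  have hΘz : Θ.symm (Ψ z) = z := Θ.left_inv hzΘ
  have hΦ : ContDiffAt ℝ 1 Θ.symm (Ψ z) := hΨ.to_localInverse hΨ' one_ne_zero
  have hΘt : Ψ z ∈ Θ.target := Θ.map_source hzΘ
  obtain ⟨ρ, hρ, hball⟩ : ∃ ρ > 0, ∀ p ∈ Metric.ball (Ψ z) ρ,
      p ∈ Θ.target ∧ ContDiffAt ℝ 1 Θ.symm p ∧ Θ.symm p ∈ U := by
    have h3 : ∀ᶠ p in 𝓝 (Ψ z), Θ.symm p ∈ U :=
      hΦ.continuousAt.eventually (by rw [hΘz]; exact hU.mem_nhds hz)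
    have h1 : ∀ᶠ p in 𝓝 (Ψ z), p ∈ Θ.target := Θ.open_target.mem_nhds hΘt
    exact Metric.eventually_nhds_iff_ball.1 (h1.and ((hΦ.eventually (by simp)).and h3))
  have hcomp : ∀ p ∈ Metric.ball (Ψ z) ρ, HasFDerivAt (fun p => g (Θ.symm p))
      ((fderiv ℝ g (Θ.symm p)).comp (fderiv ℝ Θ.symm p)) p := fun p hp =>
    (hgd _ (hball p hp).2.2).hasFDerivAt.comp p
      ((hball p hp).2.1.differentiableAt (by simp)).hasFDerivAt
  -- `A ∘ g ∘ Θ⁻¹` is the first projection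
  have hfst : ∀ p ∈ Metric.ball (Ψ z) ρ,
      (A.comp ((fderiv ℝ g (Θ.symm p)).comp (fderiv ℝ Θ.symm p))) =
        ContinuousLinearMap.fst ℝ R K := fun p hp => by
    refine (A.hasFDerivAt.comp p (hcomp p hp)).unique
      ((ContinuousLinearMap.fst ℝ R K).hasFDerivAt.congr_of_eventuallyEq ?_)
    filter_upwards [Metric.isOpen_ball.mem_nhds hp] with q hq
    exact congrArg Prod.fst (Θ.right_inv (hball q hq).1)
  -- `A` maps the range of `dg` onto `R` at nearby points; constancy of the rank makes the
  -- dimensions equal, so `A` is injective on that range. Hence `dg` vanishes in the `K`-directions,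
  -- where `A ∘ dg` does.
  have hinj : ∀ p ∈ Metric.ball (Ψ z) ρ, ∀ v, A (fderiv ℝ g (Θ.symm p) v) = 0 →
      fderiv ℝ g (Θ.symm p) v = 0 := fun p hp v hv => by
    let T := LinearMap.range (fderiv ℝ g (Θ.symm p)).toLinearMap
    have hsurj : Function.Surjective (A.toLinearMap ∘ₗ T.subtype) := fun r => by
      refine ⟨⟨fderiv ℝ g (Θ.symm p) (fderiv ℝ Θ.symm p (r, 0)), ⟨_, rfl⟩⟩, ?_⟩
      exact DFunLike.congr_fun (hfst p hp) (r, 0)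
    have hdimT : Module.finrank ℝ T = Module.finrank ℝ R :=
      (hrank _ (hball p hp).2.2).trans (hrank z hz).symm
    have hinjT := (LinearMap.injective_iff_surjective_of_finrank_eq_finrank hdimT).2 hsurj
    have h0 : (⟨fderiv ℝ g (Θ.symm p) v, ⟨v, rfl⟩⟩ : T) = 0 :=
      (injective_iff_map_eq_zero _).1 hinjT _ hv
    exact congrArg Subtype.val h0
  have hconst : ∀ (a : R) (b b' : K), (a, b) ∈ Metric.ball (Ψ z) ρ →
      (a, b') ∈ Metric.ball (Ψ z) ρ → g (Θ.symm (a, b)) = g (Θ.symm (a, b')) := fun a b b' hb hb' =>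
    eq_of_fderiv_inr_eq_zero (f := fun p => g (Θ.symm p))
      (fun p hp => (hcomp p hp).differentiableAt.differentiableWithinAt)
      (fun p hp c => by
        rw [(hcomp p hp).fderiv]
        exact hinj p hp _ (DFunLike.congr_fun (hfst p hp) (0, c))) hb hb'
  have hbase : ∀ p ∈ Metric.ball (Ψ z) ρ, (p.1, (Ψ z).2) ∈ Metric.ball (Ψ z) ρ := fun p hp => by
    rw [Metric.mem_ball, Prod.dist_eq, max_lt_iff] at hp ⊢
    exact ⟨hp.1, by rw [dist_self]; exact hρ⟩
  let γ : R → Y := fun a => g (Θ.symm (a, (Ψ z).2))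
  have hγ : ∀ p ∈ Metric.ball (Ψ z) ρ, g (Θ.symm p) = γ p.1 := fun p hp =>
    hconst p.1 p.2 (Ψ z).2 hp (hbase p hp)
  have hΘc : ContinuousOn Ψ Θ.source := Θ.continuousOn
  refine ⟨U ∩ (Θ.source ∩ Ψ ⁻¹' Metric.ball (Ψ z) ρ),
    hU.inter (hΘc.isOpen_inter_preimage Θ.open_source Metric.isOpen_ball),
    ⟨hz, hzΘ, Metric.mem_ball_self hρ⟩, inter_subset_left, R, A, γ, ?_⟩
  rintro x ⟨hxU, hxΘ, hx⟩
  have hxx : Θ.symm (Ψ x) = x := Θ.left_inv hxΘ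
  have hγd : DifferentiableAt ℝ γ (A (g x)) :=
    (HasFDerivAt.comp (g := fun p => g (Θ.symm p)) (A (g x)) (hcomp _ (hbase _ hx))
      (hasFDerivAt_prodMk_left (A (g x)) (Ψ z).2)).differentiableAt
  refine ⟨?_, hγd, ?_⟩
  · have := hγ _ hx
    rwa [hxx] at this
  · have h1 : HasFDerivAt (fun p : R × K => γ p.1)
        ((fderiv ℝ γ (A (g x))).comp (ContinuousLinearMap.fst ℝ R K)) (Ψ x) :=
      HasFDerivAt.comp (g := γ) (f := Prod.fst) (Ψ x) hγd.hasFDerivAt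
        (ContinuousLinearMap.fst ℝ R K).hasFDerivAt
    have h2 := h1.unique ((hcomp _ hx).congr_of_eventuallyEq (by
      filter_upwards [Metric.isOpen_ball.mem_nhds hx] with p hp using (hγ p hp).symm))
    rintro _ ⟨r, rfl⟩
    refine ⟨fderiv ℝ Θ.symm (Ψ x) (r, 0), ?_⟩
    have h3 := DFunLike.congr_fun h2 (r, 0)
    rw [hxx] at h3
    exact h3.symm

/-- If a map `f` takes values in the image of a small piece `K` of a map `g` of constant rank, then
`range df ⊆ range dg`. -/
theorem exists_compact_range_fderiv_le [FiniteDimensional ℝ Y] {S : Type*}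
    [NormedAddCommGroup S] [NormedSpace ℝ S]
    {g : E → Y} {U : Set E} (hU : IsOpen U)
    (hg : ContDiffOn ℝ 1 g U) {h : ℕ}
    (hrank : ∀ x ∈ U, Module.finrank ℝ (LinearMap.range (fderiv ℝ g x).toLinearMap) = h) {z : E}
    (hz : z ∈ U) :
    ∃ K ∈ 𝓝 z, IsCompact K ∧ K ⊆ U ∧ ∀ (f : S → Y) (v : S), DifferentiableAt ℝ f v →
      (∀ᶠ v' in 𝓝 v, f v' ∈ g '' K) → ∀ x ∈ K, f v = g x →
        LinearMap.range (fderiv ℝ f v).toLinearMap ≤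
          LinearMap.range (fderiv ℝ g x).toLinearMap := by
  obtain ⟨O, hO, hzO, hOU, R, A, γ, hγ⟩ := exists_constant_rank_factorization hU hg hrank hz
  obtain ⟨K, hK, hKO, hKc⟩ := local_compact_nhds (hO.mem_nhds hzO)
  refine ⟨K, hK, hKc, hKO.trans hOU, fun f v hf hev x hx hfx => ?_⟩
  obtain ⟨-, hd, hle⟩ := hγ x (hKO hx)
  refine le_trans ?_ hle
  have hd' : HasFDerivAt γ (fderiv ℝ γ (A (g x))) (A (f v)) := by
    rw [hfx]; exact hd.hasFDerivAt
  -- All values of `f` near `v` lie in `g '' K`, where `γ ∘ A` is the identity; so `f = γ ∘ A ∘ f`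
  -- near `v`, and `range df ⊆ range dγ`.
  have h1 := (hd'.comp v (A.hasFDerivAt.comp v hf.hasFDerivAt)).congr_of_eventuallyEq (f₁ := f) (by
    filter_upwards [hev] with v' hv'
    obtain ⟨x', hx', hfx'⟩ := hv'
    change f v' = γ (A (f v'))
    rw [← hfx']
    exact (hγ x' (hKO hx')).1)
  rw [h1.fderiv]
  rintro _ ⟨u, rfl⟩
  exact ⟨A (fderiv ℝ f v u), rfl⟩

end ConstantRank

/-! ### Maps between manifolds in charts. -/

section Coordinates

variable {p m : ℕ}
  {P : Type*} [TopologicalSpace P] [ChartedSpace (EuclideanSpace ℝ (Fin p)) P]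
  {Q : Type*} [TopologicalSpace Q] [ChartedSpace (EuclideanSpace ℝ (Fin m)) Q]

/-- The derivative of the chart around `q₀`, as a map between the model spaces. -/
def chartDeriv (q₀ q : Q) : EuclideanSpace ℝ (Fin m) →L[ℝ] EuclideanSpace ℝ (Fin m) :=
  mfderiv (𝓡 m) 𝓘(ℝ, EuclideanSpace ℝ (Fin m)) (extChartAt (𝓡 m) q₀) q

/-- `f` in the charts around `z₀` and `q₀`. -/
def inCharts (f : P → Q) (z₀ : P) (q₀ : Q) (y : EuclideanSpace ℝ (Fin p)) :
    EuclideanSpace ℝ (Fin m) :=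
  extChartAt (𝓡 m) q₀ (f ((extChartAt (𝓡 p) z₀).symm y))

/-- The domain of `f` in the charts around `z₀` and `q₀`. -/
def inChartsDomain (f : P → Q) (z₀ : P) (q₀ : Q) : Set (EuclideanSpace ℝ (Fin p)) :=
  (extChartAt (𝓡 p) z₀).target ∩
    (fun y => f ((extChartAt (𝓡 p) z₀).symm y)) ⁻¹' (extChartAt (𝓡 m) q₀).source

theorem isOpen_inChartsDomain {f : P → Q} (hf : ContMDiff (𝓡 p) (𝓡 m) ∞ f) (z₀ : P) (q₀ : Q) :
    IsOpen (inChartsDomain (p := p) (m := m) f z₀ q₀) :=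
  (hf.continuous.comp_continuousOn (continuousOn_extChartAt_symm z₀)).isOpen_inter_preimage
    (isOpen_extChartAt_target z₀) (isOpen_extChartAt_source q₀)

theorem mem_inChartsDomain {f : P → Q} {z₀ z : P} {q₀ : Q}
    (hz : z ∈ (extChartAt (𝓡 p) z₀).source) (hq : f z ∈ (extChartAt (𝓡 m) q₀).source) :
    extChartAt (𝓡 p) z₀ z ∈ inChartsDomain (p := p) (m := m) f z₀ q₀ :=
  ⟨(extChartAt (𝓡 p) z₀).map_source hz, by
    rwa [mem_preimage, (extChartAt (𝓡 p) z₀).left_inv hz]⟩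

variable [IsManifold (𝓡 p) ∞ P] [IsManifold (𝓡 m) ∞ Q]

theorem chartDeriv_injective {q₀ q : Q} (hq : q ∈ (extChartAt (𝓡 m) q₀).source) :
    Function.Injective (chartDeriv (m := m) q₀ q) :=
  (isInvertible_mfderiv_extChartAt (I := 𝓡 m) hq).injective

theorem exists_hasMFDerivAt_extChartAt_symm {z₀ : P} {y : EuclideanSpace ℝ (Fin p)}
    (hy : y ∈ (extChartAt (𝓡 p) z₀).target) :
    ∃ D : EuclideanSpace ℝ (Fin p) →L[ℝ] EuclideanSpace ℝ (Fin p),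
      HasMFDerivAt 𝓘(ℝ, EuclideanSpace ℝ (Fin p)) (𝓡 p) (extChartAt (𝓡 p) z₀).symm y D ∧
        Function.Surjective D := by
  have hzs := (extChartAt (𝓡 p) z₀).map_target hy
  have h3 : HasMFDerivAt 𝓘(ℝ, EuclideanSpace ℝ (Fin p)) (𝓡 p) (extChartAt (𝓡 p) z₀).symm y
      (mfderiv 𝓘(ℝ, EuclideanSpace ℝ (Fin p)) (𝓡 p) (extChartAt (𝓡 p) z₀).symm y) :=
    (((contMDiffOn_extChartAt_symm (n := ∞) z₀).contMDiffAt
      ((isOpen_extChartAt_target z₀).mem_nhds hy)).mdifferentiableAt (by simp)).hasMFDerivAt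
  refine ⟨_, h3, fun v => ?_⟩
  have h4 : HasMFDerivAt (𝓡 p) 𝓘(ℝ, EuclideanSpace ℝ (Fin p)) (extChartAt (𝓡 p) z₀)
      ((extChartAt (𝓡 p) z₀).symm y)
      (chartDeriv (m := p) z₀ ((extChartAt (𝓡 p) z₀).symm y)) :=
    (mdifferentiableAt_extChartAt (by rwa [extChartAt_source] at hzs)).hasMFDerivAt
  have h5 := h3
  rw [← (extChartAt (𝓡 p) z₀).right_inv hy] at h5
  have h6 := (h5.comp _ h4).congr_of_eventuallyEq (f₁ := id) (by
    filter_upwards [(isOpen_extChartAt_source z₀).mem_nhds hzs] with z' hz'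
      using ((extChartAt (𝓡 p) z₀).left_inv hz').symm)
  have h7 := DFunLike.congr_fun (hasMFDerivAt_unique h6 (hasMFDerivAt_id _)) v
  rw [(extChartAt (𝓡 p) z₀).right_inv hy] at h7
  exact ⟨_, h7⟩

theorem contDiffOn_inCharts {f : P → Q} (hf : ContMDiff (𝓡 p) (𝓡 m) ∞ f) (z₀ : P) (q₀ : Q) :
    ContDiffOn ℝ ∞ (inCharts (p := p) (m := m) f z₀ q₀)
      (inChartsDomain (p := p) (m := m) f z₀ q₀) := by
  rw [← contMDiffOn_iff_contDiffOn]
  exact (contMDiffOn_extChartAt (I := 𝓡 m) (n := ∞) (x := q₀)).comp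
    (hf.comp_contMDiffOn ((contMDiffOn_extChartAt_symm (n := ∞) z₀).mono inter_subset_left))
    (fun y hy => by
      have := hy.2
      rwa [mem_preimage, extChartAt_source] at this)

/-- The source chart has invertible derivative and leaves the range unchanged; the target chart
transports it. -/
theorem range_fderiv_inCharts {f : P → Q} (hf : ContMDiff (𝓡 p) (𝓡 m) ∞ f) {z₀ : P} {q₀ : Q}
    {y : EuclideanSpace ℝ (Fin p)} (hy : y ∈ inChartsDomain (p := p) (m := m) f z₀ q₀) :
    LinearMap.range (fderiv ℝ (inCharts (p := p) (m := m) f z₀ q₀) y).toLinearMap =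
      (LinearMap.range
        (modelDeriv (k := p) (m := m) f ((extChartAt (𝓡 p) z₀).symm y)).toLinearMap).map
        (chartDeriv (m := m) q₀ (f ((extChartAt (𝓡 p) z₀).symm y))).toLinearMap := by
  set z := (extChartAt (𝓡 p) z₀).symm y with hz
  have hzs : z ∈ (extChartAt (𝓡 p) z₀).source := (extChartAt (𝓡 p) z₀).map_target hy.1
  have h1 : HasMFDerivAt (𝓡 p) (𝓡 m) f z (modelDeriv (k := p) (m := m) f z) :=
    ((hf z).mdifferentiableAt (by simp)).hasMFDerivAt
  have hqs := hy.2
  rw [mem_preimage, extChartAt_source, ← hz] at hqs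
  have h2 : HasMFDerivAt (𝓡 m) 𝓘(ℝ, EuclideanSpace ℝ (Fin m)) (extChartAt (𝓡 m) q₀) (f z)
      (chartDeriv (m := m) q₀ (f z)) := (mdifferentiableAt_extChartAt hqs).hasMFDerivAt
  obtain ⟨D, hD, hDsurj⟩ := exists_hasMFDerivAt_extChartAt_symm hy.1
  have h3 : HasFDerivAt (inCharts (p := p) (m := m) f z₀ q₀)
      ((chartDeriv (m := m) q₀ (f z)).comp ((modelDeriv (k := p) (m := m) f z).comp D)) y :=
    (h2.comp y (h1.comp y hD)).hasFDerivAt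
  rw [h3.fderiv]
  ext w
  constructor
  · rintro ⟨u, rfl⟩
    exact ⟨_, ⟨D u, rfl⟩, rfl⟩
  · rintro ⟨_, ⟨u, rfl⟩, rfl⟩
    obtain ⟨u, rfl⟩ := hDsurj u
    exact ⟨u, rfl⟩

theorem finrank_range_fderiv_inCharts {f : P → Q} (hf : ContMDiff (𝓡 p) (𝓡 m) ∞ f) {z₀ : P}
    {q₀ : Q} {y : EuclideanSpace ℝ (Fin p)} (hy : y ∈ inChartsDomain (p := p) (m := m) f z₀ q₀) :
    Module.finrank ℝ
        (LinearMap.range (fderiv ℝ (inCharts (p := p) (m := m) f z₀ q₀) y).toLinearMap) =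
      Module.finrank ℝ
        (LinearMap.range
          (modelDeriv (k := p) (m := m) f ((extChartAt (𝓡 p) z₀).symm y)).toLinearMap) := by
  rw [range_fderiv_inCharts hf hy]
  exact (Submodule.equivMapOfInjective _ (chartDeriv_injective hy.2) _).finrank_eq.symm

end Coordinates

/-! ### Comparing smooth maps through their images as sets. -/

section ConstantRankManifold

variable {p m s : ℕ}
  {P : Type*} [TopologicalSpace P]
  [ChartedSpace (EuclideanSpace ℝ (Fin p)) P] [IsManifold (𝓡 p) ∞ P]
  {Q : Type*} [TopologicalSpace Q] [ChartedSpace (EuclideanSpace ℝ (Fin m)) Q]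
  [IsManifold (𝓡 m) ∞ Q]
  {S : Type*} [TopologicalSpace S]
  [ChartedSpace (EuclideanSpace ℝ (Fin s)) S] [IsManifold (𝓡 s) ∞ S]

section Rank

variable [SecondCountableTopology S]

/-- If the image of `g` is contained in that of a smooth map from an `s`-dimensional manifold, then
the rank of `g` is at most `s`. -/
theorem finrank_range_modelDeriv_le {g : P → Q} (hg : ContMDiff (𝓡 p) (𝓡 m) ∞ g) {f : S → Q}
    (hf : ContMDiff (𝓡 s) (𝓡 m) ∞ f) (hsub : range g ⊆ range f) (z : P) :
    Module.finrank ℝ (LinearMap.range (modelDeriv (k := p) (m := m) g z).toLinearMap) ≤ s := by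
  have hzs := mem_extChartAt_source (I := 𝓡 p) z
  have hqs := mem_extChartAt_source (I := 𝓡 m) (g z)
  have hy := mem_inChartsDomain hzs hqs
  set y := extChartAt (𝓡 p) z z with hydef
  have hyz : (extChartAt (𝓡 p) z).symm y = z := (extChartAt (𝓡 p) z).left_inv hzs
  have hfin := finrank_range_fderiv_inCharts hg hy
  rw [hyz] at hfin
  rw [← hfin]
  let R := LinearMap.range (fderiv ℝ (inCharts (p := p) (m := m) g z (g z)) y).toLinearMap
  -- After projection to the range `R` of its derivative, `g` becomes a submersion at `y`, hence
  -- covers a neighbourhood in `R`. The projection of `f` covers it too, and the dimension bound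
  -- applies.
  obtain ⟨A, hA⟩ := Submodule.ClosedComplemented.of_finiteDimensional (𝕜 := ℝ) R
  have hopen := isOpen_inChartsDomain hg z (g z)
  have hstrict : HasStrictFDerivAt (fun y => A (inCharts (p := p) (m := m) g z (g z) y))
      (A.comp (fderiv ℝ (inCharts (p := p) (m := m) g z (g z)) y)) y :=
    A.hasStrictFDerivAt.comp y (((contDiffOn_inCharts hg z (g z)).contDiffAt
      (hopen.mem_nhds hy)).hasStrictFDerivAt (by simp))
  have hsurj : LinearMap.range
      (A.comp (fderiv ℝ (inCharts (p := p) (m := m) g z (g z)) y)).toLinearMap = ⊤ :=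
    LinearMap.range_eq_top.2 fun r => by
      obtain ⟨u, hu⟩ := r.2
      refine ⟨u, ?_⟩
      have h1 : fderiv ℝ (inCharts (p := p) (m := m) g z (g z)) y u = r := hu
      change A (fderiv ℝ (inCharts (p := p) (m := m) g z (g z)) y u) = r
      rw [h1, hA]
  have hmap := hstrict.map_nhds_eq_of_surj hsurj
  have hsmooth : ContMDiffOn (𝓡 s) 𝓘(ℝ, R) ∞ (fun v => A (extChartAt (𝓡 m) (g z) (f v)))
      (f ⁻¹' (extChartAt (𝓡 m) (g z)).source) :=
    A.contDiff.contMDiff.comp_contMDiffOn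
      ((contMDiffOn_extChartAt (I := 𝓡 m) (n := ∞) (x := g z)).comp hf.contMDiffOn
        (fun v hv => by rwa [mem_preimage, extChartAt_source] at hv))
  refine finrank_le_of_image_mem_nhds
    ((isOpen_extChartAt_source (g z)).preimage hf.continuous) hsmooth
    (y := A (inCharts (p := p) (m := m) g z (g z) y)) ?_
  rw [← hmap, Filter.mem_map]
  filter_upwards [hopen.mem_nhds hy] with y' hy'
  obtain ⟨v, hv⟩ := hsub (mem_range_self ((extChartAt (𝓡 p) z).symm y'))
  refine ⟨v, ?_, ?_⟩
  · rw [mem_preimage, hv]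
    exact hy'.2
  · simp only [hv]
    rfl

end Rank

section Density

variable [SecondCountableTopology P] [T2Space Q] [T2Space S]

/-- If `f : S → Q` takes values in the image of a map `g` of constant rank, then at a dense set of
points the image of `df` is contained in the image of `dg`. -/
theorem dense_range_modelDeriv_le {g : P → Q} (hg : ContMDiff (𝓡 p) (𝓡 m) ∞ g) {h : ℕ}
    (hrank : ∀ z, Module.finrank ℝ
      (LinearMap.range (modelDeriv (k := p) (m := m) g z).toLinearMap) = h)
    {f : S → Q} (hf : ContMDiff (𝓡 s) (𝓡 m) ∞ f) (hsub : range f ⊆ range g) :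
    Dense {v : S | ∃ z : P, f v = g z ∧
      LinearMap.range (modelDeriv (k := s) (m := m) f v).toLinearMap ≤
      LinearMap.range (modelDeriv (k := p) (m := m) g z).toLinearMap} := by
  have : LocallyCompactSpace S := ChartedSpace.locallyCompactSpace (EuclideanSpace ℝ (Fin s)) S
  have hlocal : ∀ z : P, ∃ K ∈ 𝓝 z, IsCompact K ∧ ∀ v : S, (∀ᶠ v' in 𝓝 v, f v' ∈ g '' K) →
      ∃ z' : P, f v = g z' ∧ LinearMap.range (modelDeriv (k := s) (m := m) f v).toLinearMap ≤
        LinearMap.range (modelDeriv (k := p) (m := m) g z').toLinearMap := fun z => by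
    have hzs := mem_extChartAt_source (I := 𝓡 p) z
    have hqs := mem_extChartAt_source (I := 𝓡 m) (g z)
    have hopen := isOpen_inChartsDomain hg z (g z)
    obtain ⟨K, hK, hKc, hKU, hkey⟩ := exists_compact_range_fderiv_le
      (S := EuclideanSpace ℝ (Fin s)) hopen ((contDiffOn_inCharts hg z (g z)).of_le (by simp))
      (fun y hy => (finrank_range_fderiv_inCharts hg hy).trans (hrank _))
      (mem_inChartsDomain hzs hqs)
    have hcont : ContinuousOn (extChartAt (𝓡 p) z).symm K :=
      (continuousOn_extChartAt_symm z).mono fun y hy => (hKU hy).1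
    refine ⟨(extChartAt (𝓡 p) z).symm '' K, ?_, hKc.image_of_continuousOn hcont, ?_⟩
    · filter_upwards [(continuousAt_extChartAt (I := 𝓡 p) z).preimage_mem_nhds hK,
        (isOpen_extChartAt_source z).mem_nhds hzs] with z' hz' hz's
      exact ⟨_, hz', (extChartAt (𝓡 p) z).left_inv hz's⟩
    · intro v hv
      obtain ⟨_, ⟨y, hy, rfl⟩, hyv⟩ := hv.self_of_nhds
      refine ⟨_, hyv.symm, ?_⟩
      have hvs := mem_extChartAt_source (I := 𝓡 s) v
      have hfv : f v ∈ (extChartAt (𝓡 m) (g z)).source := hyv ▸ (hKU hy).2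
      have hvd := mem_inChartsDomain hvs hfv
      have hsymm : (extChartAt (𝓡 s) v).symm (extChartAt (𝓡 s) v v) = v :=
        (extChartAt (𝓡 s) v).left_inv hvs
      have hle := hkey (inCharts (p := s) (m := m) f v (g z)) (extChartAt (𝓡 s) v v)
        (((contDiffOn_inCharts hf v (g z)).contDiffAt
          ((isOpen_inChartsDomain hf v (g z)).mem_nhds hvd)).differentiableAt (by simp)) ?_ y hy ?_
      · rw [range_fderiv_inCharts hf hvd, range_fderiv_inCharts hg (hKU hy), hsymm, ← hyv] at hle
        exact (Submodule.map_le_map_iff_of_injective (chartDeriv_injective (hKU hy).2) _ _).1 hle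
      · have h1 : ContinuousAt (extChartAt (𝓡 s) v).symm (extChartAt (𝓡 s) v v) :=
          continuousAt_extChartAt_symm v
        have h2 := h1.eventually (hsymm.symm ▸ hv)
        filter_upwards [h2] with y' hy'
        obtain ⟨_, ⟨y'', hy'', rfl⟩, he⟩ := hy'
        exact ⟨y'', hy'', congrArg (extChartAt (𝓡 m) (g z)) he⟩
      · simp only [inCharts, hsymm, hyv]
  choose K hK hKc hkey using hlocal
  obtain ⟨T, hT, hcover⟩ := TopologicalSpace.countable_cover_nhds hK
  -- Baire's theorem: countably many closed sets `f ⁻¹' (g '' K z)` cover the locally compact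
  -- Hausdorff space `S`, so their interiors have dense union.
  have hdense : Dense (⋃ z ∈ T, interior (f ⁻¹' (g '' K z))) := by
    refine dense_biUnion_interior_of_closed (fun z _ =>
      (((hKc z).image hg.continuous).isClosed).preimage hf.continuous) hT ?_
    refine eq_univ_of_forall fun v => ?_
    obtain ⟨z, hz⟩ := hsub (mem_range_self v)
    obtain ⟨t, ht, hzt⟩ := mem_iUnion₂.1 (hcover ▸ mem_univ z)
    exact mem_iUnion₂.2 ⟨t, ht, z, hzt, hz⟩
  refine hdense.mono fun v hv => ?_
  obtain ⟨z, -, hz⟩ := mem_iUnion₂.1 hv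
  exact hkey z v (mem_interior_iff_mem_nhds.1 hz)

end Density

end ConstantRankManifold

/-! ### Smooth forms vanishing on a dense set. -/

section DenseVanishing

variable {s k : ℕ} {S : Type*} [TopologicalSpace S] [ChartedSpace (EuclideanSpace ℝ (Fin s)) S]
  [IsManifold (𝓡 s) ∞ S]

/-- A smooth form which vanishes on a dense set vanishes. -/
theorem FormField.eq_zero_of_dense {α : FormField s S k} (hα : α.IsSmooth)
    (hd : Dense {v | α v = 0}) (v : S) : α v = 0 := by
  have hvs := mem_extChartAt_source (I := 𝓡 s) v
  have hc : ContinuousAt (α.inChart v) (extChartAt (𝓡 s) v v) :=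
    ((hα v).contDiffAt ((isOpen_extChartAt_target v).mem_nhds
      (mem_extChartAt_target v))).continuousAt
  have h0 : α.inChart v (extChartAt (𝓡 s) v v) = 0 := by
    by_contra hne
    have h1 := (continuousAt_extChartAt (I := 𝓡 s) v).eventually (hc.eventually_ne hne)
    have h2 := h1.and ((isOpen_extChartAt_source (I := 𝓡 s) v).mem_nhds hvs)
    obtain ⟨v', hv', hne', hs'⟩ := (mem_closure_iff_frequently.1 (hd v)).and_eventually h2 |>.exists
    refine hne' ?_
    rw [inChart, (extChartAt (𝓡 s) v).left_inv hs', hv']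
    rfl
  obtain ⟨D, hD, hDsurj⟩ := exists_hasMFDerivAt_extChartAt_symm (mem_extChartAt_target (I := 𝓡 s) v)
  have h1 : (α.val v).compContinuousLinearMap D = 0 :=
    (α.pullbackVec_eq ((extChartAt (𝓡 s) v).left_inv hvs) hD).symm.trans h0
  refine (?_ : α.val v = 0)
  ext u
  choose u' hu' using fun i => hDsurj (u i)
  obtain rfl : (fun i => D (u' i)) = u := funext hu'
  exact DFunLike.congr_fun h1 u'

end DenseVanishing

/-! ### Reduction of stable Hamiltonian structures. -/

section Reduction

variable {n k m : ℕ}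
  {M : Type*} [TopologicalSpace M] [ChartedSpace (EuclideanSpace ℝ (Fin (2 * n + 1))) M]
  {N : Type*} [TopologicalSpace N] [ChartedSpace (EuclideanSpace ℝ (Fin k)) N]
  {Q : Type*} [TopologicalSpace Q] [ChartedSpace (EuclideanSpace ℝ (Fin m)) Q]
  {Ω : FormField (2 * n + 1) M 2} {lam : FormField (2 * n + 1) M 1} {i : N → M} {π : N → Q}

theorem pullback_apply_pair {d e : ℕ} {M : Type*} [TopologicalSpace M]
    [ChartedSpace (EuclideanSpace ℝ (Fin d)) M] {N : Type*} [TopologicalSpace N]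
    [ChartedSpace (EuclideanSpace ℝ (Fin e)) N] (α : FormField d M 2) (f : N → M) (x : N)
    (u v : EuclideanSpace ℝ (Fin e)) :
    (α.pullback f : FormField e N 2).val x ![u, v] =
      α.val (f x) ![modelDeriv (k := e) (m := d) f x u, modelDeriv (k := e) (m := d) f x v] :=
  comp_pair (modelDeriv (k := e) (m := d) f x) u v

/-- The restriction of `Ω` to a horizontal submanifold vanishes on the characteristic
distribution. -/
theorem pullback_apply_eq_zero (hM : IsStableHamiltonian Ω lam)
    (hhor : IsHorizontal (k := k) lam i) (x : N) {u : TangentSpace (𝓡 k) x}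
    (hu : u ∈ characteristicDistribution (k := k) Ω lam i x) (v : TangentSpace (𝓡 k) x) :
    (Ω.pullback i : FormField k N 2) x ![u, v] = 0 :=
  (pullback_apply_pair Ω i x u v).trans
    (form_eq_zero_of_mem_bivectorOrth (n := n) (A := (modelDeriv (k := k) i x).toLinearMap)
      finrank_euclideanSpace_fin (hM.volume (i x)) (hhor x) hu v)

/-- The kernel of `i^*Ω` is the characteristic distribution, which is the kernel of `dπ`, so nothing
degenerate survives in the quotient. -/
theorem contraction_injective_of_pullback_eq (hM : IsStableHamiltonian Ω lam)
    (hhor : IsHorizontal (k := k) lam i)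
    (hleaf : IsLeafProjection (characteristicDistribution (k := k) Ω lam i) π)
    (hπ : Manifold.IsSubmersion (𝓡 k) (𝓡 m) ∞ π) {σ : FormField m Q 2}
    (hσ : (σ.pullback π : FormField k N 2) = Ω.pullback i) (q : Q) :
    Function.Injective (contraction (σ.val q)) := by
  obtain ⟨x, rfl⟩ := hleaf.surjective q
  refine contraction_injective_of_reduction (n := n) (w := Ω.val (i x)) (l := lam.val (i x))
    (A := (modelDeriv (k := k) i x).toLinearMap)
    (p := (modelDeriv (k := k) (m := m) π x).toLinearMap)
    finrank_euclideanSpace_fin (hM.volume (i x)) (hhor x)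
    (mfderiv_surjective_of_isSubmersion hπ x) (hleaf.ker_mfderiv_eq hπ x) fun u v => ?_
  refine (pullback_apply_pair σ π x u v).symm.trans ?_
  rw [hσ]
  exact pullback_apply_pair Ω i x u v

theorem eq_of_pullback_eq (hπ : Manifold.IsSubmersion (𝓡 k) (𝓡 m) ∞ π)
    (hsurj : Function.Surjective π) {σ τ : FormField m Q 2}
    (h : (σ.pullback π : FormField k N 2) = τ.pullback π) : σ = τ := by
  funext q
  obtain ⟨x, rfl⟩ := hsurj q
  exact twoForm_comp_injective (w := σ.val (π x)) (w' := τ.val (π x))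
    (p := modelDeriv (k := k) (m := m) π x)
    (mfderiv_surjective_of_isSubmersion hπ x) (congrFun h x)

theorem exists_symplectic_reduction [IsManifold (𝓡 (2 * n + 1)) ∞ M] [IsManifold (𝓡 k) ∞ N]
    [IsManifold (𝓡 m) ∞ Q] (hM : IsStableHamiltonian Ω lam)
    (hi : IsSubmanifold k (2 * n + 1) i) (hhor : IsHorizontal (k := k) lam i)
    (hleaf : IsLeafProjection (characteristicDistribution (k := k) Ω lam i) π)
    (hπ : Manifold.IsSubmersion (𝓡 k) (𝓡 m) ∞ π) :
    ∃ σ : FormField m Q 2, IsSymplectic σ ∧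
      (σ.pullback π : FormField k N 2) = Ω.pullback i := by
  obtain ⟨σ, hs, hc, hσ⟩ := exists_descended_form hleaf hπ
    (hM.smooth_two.pullback hi.immersion.contMDiff)
    (FormField.extD_pullback_eq_zero hM.smooth_two hM.closed hi.immersion.contMDiff)
    (fun x u hu v => pullback_apply_eq_zero hM hhor x hu v)
  refine ⟨σ, ⟨hs, hc, fun q => ?_⟩, hσ⟩
  exact bijective_contraction (contraction_injective_of_pullback_eq hM hhor hleaf hπ hσ q)

section Lagrangian

variable {l p : ℕ}
  {L : Type*} [TopologicalSpace L] [ChartedSpace (EuclideanSpace ℝ (Fin l)) L]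
  {P : Type*} [TopologicalSpace P] [ChartedSpace (EuclideanSpace ℝ (Fin p)) P]
  {iL : L → M} {jL : P → L} {jN : P → N}

/-- The images in the leaf space of the tangent spaces of the clean intersection are Lagrangian. -/
theorem formOrth_range_modelDeriv_eq (hM : IsStableHamiltonian Ω lam)
    (hi : IsSubmanifold k (2 * n + 1) i) (hhor : IsHorizontal (k := k) lam i)
    (hcoiso : IsCoisotropic (k := k) Ω lam i)
    (hleaf : IsLeafProjection (characteristicDistribution (k := k) Ω lam i) π)
    (hπ : Manifold.IsSubmersion (𝓡 k) (𝓡 m) ∞ π) {σ : FormField m Q 2}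
    (hσ : (σ.pullback π : FormField k N 2) = Ω.pullback i)
    (hL : IsLagrangian (k := l) Ω lam iL)
    (hclean : IsCleanIntersection (d := 2 * n + 1) (l := l) (k := k) (p := p) iL i jL jN) (z : P) :
    formOrth (σ.val (π (jN z)))
        (LinearMap.range (modelDeriv (k := p) (m := m) (π ∘ jN) z).toLinearMap) =
      LinearMap.range (modelDeriv (k := p) (m := m) (π ∘ jN) z).toLinearMap := by
  have hj : MDifferentiableAt (𝓡 p) (𝓡 k) jN z :=
    (hclean.smooth_right z).mdifferentiableAt (by simp)
  have hcomp : LinearMap.range (modelDeriv (k := p) (m := m) (π ∘ jN) z).toLinearMap =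
      (LinearMap.range (modelDeriv (k := p) (m := k) jN z).toLinearMap).map
        (modelDeriv (k := k) (m := m) π (jN z)).toLinearMap := by
    rw [← LinearMap.range_comp]
    exact congrArg (fun D : EuclideanSpace ℝ (Fin p) →L[ℝ] EuclideanSpace ℝ (Fin m) =>
      LinearMap.range D.toLinearMap)
      (mfderiv_comp z ((hπ.contMDiff (jN z)).mdifferentiableAt (by simp)) hj)
  -- Cleanness enters here, through the equality `T(L ∩ N) = TL ∩ TN` of tangent spaces.
  have hZ : (LinearMap.range (modelDeriv (k := p) (m := k) jN z).toLinearMap).map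
        (modelDeriv (k := k) (m := 2 * n + 1) i (jN z)).toLinearMap =
      LinearMap.range (modelDeriv (k := l) (m := 2 * n + 1) iL (jL z)).toLinearMap ⊓
        LinearMap.range (modelDeriv (k := k) (m := 2 * n + 1) i (jN z)).toLinearMap := by
    rw [← LinearMap.range_comp]
    refine Eq.trans ?_ (hclean.tangent z)
    exact congrArg (fun D : EuclideanSpace ℝ (Fin p) →L[ℝ] EuclideanSpace ℝ (Fin (2 * n + 1)) =>
      LinearMap.range D.toLinearMap)
      (mfderiv_comp z ((hi.immersion.contMDiff (jN z)).mdifferentiableAt (by simp)) hj).symm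
  have hC : bivectorOrth (Ω.val (iL (jL z))) (lam.val (iL (jL z)))
        (LinearMap.range (modelDeriv (k := l) (m := 2 * n + 1) iL (jL z)).toLinearMap) =
      LinearMap.range (modelDeriv (k := l) (m := 2 * n + 1) iL (jL z)).toLinearMap ⊓
        LinearMap.ker (functional (lam.val (iL (jL z)))) := hL (jL z)
  rw [hclean.comm z] at hC
  rw [hcomp]
  refine formOrth_map_eq_of_reduction (n := n) (w := Ω.val (i (jN z))) (l := lam.val (i (jN z)))
    finrank_euclideanSpace_fin (hM.volume (i (jN z))) (hhor (jN z)) (hcoiso (jN z))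
    (mfderiv_surjective_of_isSubmersion hπ (jN z)) (hleaf.ker_mfderiv_eq hπ (jN z))
    (fun u v => ?_) hC hZ
  refine (pullback_apply_pair σ π (jN z) u v).symm.trans ?_
  rw [hσ]
  exact pullback_apply_pair Ω i (jN z) u v

end Lagrangian

section Image

variable {p s : ℕ}
  {P : Type*} [TopologicalSpace P] [SecondCountableTopology P]
  [ChartedSpace (EuclideanSpace ℝ (Fin p)) P] [IsManifold (𝓡 p) ∞ P]
  {S : Type*} [TopologicalSpace S] [T2Space S] [SecondCountableTopology S]
  [ChartedSpace (EuclideanSpace ℝ (Fin s)) S] [IsManifold (𝓡 s) ∞ S]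

/-- A submanifold which is, as a set, the image of a smooth map all of whose tangential images are
Lagrangian is itself Lagrangian. -/
theorem isLagrangianSymplectic_of_range_eq [T2Space Q] [IsManifold (𝓡 m) ∞ Q]
    {σ : FormField m Q 2} (hσ : IsSymplectic σ) {g : P → Q}
    (hg : ContMDiff (𝓡 p) (𝓡 m) ∞ g)
    (hlag : ∀ z, formOrth (σ.val (g z))
        (LinearMap.range (modelDeriv (k := p) (m := m) g z).toLinearMap) =
      LinearMap.range (modelDeriv (k := p) (m := m) g z).toLinearMap)
    {f : S → Q} (hf : IsSubmanifold s m f) (hrange : range f = range g) :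
    IsLagrangianSymplectic (s := s) σ f := by
  have hinj : ∀ q, Function.Injective (contraction (σ.val q)) := fun q => (hσ.nondegenerate q).1
  have hfs := hf.immersion.contMDiff
  -- A Lagrangian subspace has half the dimension, so `g` has constant rank.
  have hrank : ∀ z, Module.finrank ℝ
      (LinearMap.range (modelDeriv (k := p) (m := m) g z).toLinearMap) = m / 2 := fun z => by
    have h := finrank_formOrth (hinj (g z))
      (LinearMap.range (modelDeriv (k := p) (m := m) g z).toLinearMap)
    rw [hlag, finrank_euclideanSpace_fin] at h
    omega
  -- Where `range df ⊆ range dg`, the form vanishes on `range df` because `range dg` is Lagrangian;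
  -- density and continuity do the rest.
  have hzero : ∀ v, (σ.pullback f : FormField s S 2) v = 0 := by
    refine FormField.eq_zero_of_dense (hσ.smooth.pullback hfs)
      ((dense_range_modelDeriv_le hg hrank hfs hrange.subset).mono ?_)
    rintro v ⟨z, hz, hle⟩
    refine twoForm_ext (w := (σ.pullback f : FormField s S 2).val v) (w' := 0) fun u u' => ?_
    have hu := hle ⟨u, rfl⟩
    rw [pullback_apply_pair, hz]
    rw [← hlag z] at hu
    exact hu _ (hle ⟨u', rfl⟩)
  intro v
  obtain ⟨z, hz⟩ := hrange.subset (mem_range_self v)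
  have hK := hlag z
  rw [hz] at hK
  refine formOrth_eq_of_isotropic (hinj (f v)) hK ?_ ?_
  · rintro _ ⟨u, rfl⟩ _ ⟨u', rfl⟩
    exact (pullback_apply_pair σ f v u u').symm.trans
      (DFunLike.congr_fun (hzero v) ![u, u'])
  · refine (finrank_range_modelDeriv_le hg hfs hrange.superset z).trans_eq ?_
    exact ((LinearMap.finrank_range_of_inj
      (f := (modelDeriv (k := s) (m := m) f v).toLinearMap)
      (mfderiv_injective_of_isImmersion hf.immersion v)).trans finrank_euclideanSpace_fin).symm

end Image

end Reduction

end StableHamiltonian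

end

theorem mainTheorem10
    {n k m : ℕ}
    {M : Type*} [TopologicalSpace M] [T2Space M] [SecondCountableTopology M]
    [ChartedSpace (EuclideanSpace ℝ (Fin (2 * n + 1))) M] [IsManifold (𝓡 (2 * n + 1)) ∞ M]
    {N : Type*} [TopologicalSpace N] [T2Space N] [SecondCountableTopology N]
    [ChartedSpace (EuclideanSpace ℝ (Fin k)) N] [IsManifold (𝓡 k) ∞ N]
    {Q : Type*} [TopologicalSpace Q] [T2Space Q] [SecondCountableTopology Q]
    [ChartedSpace (EuclideanSpace ℝ (Fin m)) Q] [IsManifold (𝓡 m) ∞ Q]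
    (Ω : FormField (2 * n + 1) M 2) (lam : FormField (2 * n + 1) M 1)
    (hM : IsStableHamiltonian Ω lam)
    (i : N → M) (hi : IsSubmanifold k (2 * n + 1) i)
    (hcoiso : IsCoisotropic (k := k) Ω lam i)
    (hhor : IsHorizontal (k := k) lam i)
    (hint : IsIntegrable (characteristicDistribution (k := k) Ω lam i))
    (π : N → Q) (hleaf : IsLeafProjection (characteristicDistribution (k := k) Ω lam i) π)
    (hπ : Manifold.IsSubmersion (𝓡 k) (𝓡 m) ∞ π) :
    (∃! ΩN : FormField m Q 2,
      IsSymplectic ΩN ∧ (ΩN.pullback π : FormField k N 2) = Ω.pullback i) ∧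
    ∀ ΩN : FormField m Q 2,
      IsSymplectic ΩN ∧ (ΩN.pullback π : FormField k N 2) = Ω.pullback i →
      ∀ {l p s : ℕ}
        {L : Type*} [TopologicalSpace L] [T2Space L] [SecondCountableTopology L]
        [ChartedSpace (EuclideanSpace ℝ (Fin l)) L] [IsManifold (𝓡 l) ∞ L]
        {P : Type*} [TopologicalSpace P] [T2Space P] [SecondCountableTopology P]
        [ChartedSpace (EuclideanSpace ℝ (Fin p)) P] [IsManifold (𝓡 p) ∞ P]
        {S : Type*} [TopologicalSpace S] [T2Space S] [SecondCountableTopology S]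
        [ChartedSpace (EuclideanSpace ℝ (Fin s)) S] [IsManifold (𝓡 s) ∞ S]
        (iL : L → M) (jL : P → L) (jN : P → N) (iS : S → Q),
        IsSubmanifold l (2 * n + 1) iL →
        IsLagrangian (k := l) Ω lam iL →
        IsCleanIntersection (d := 2 * n + 1) (l := l) (k := k) (p := p) iL i jL jN →
        IsSubmanifold s m iS →
        Set.range iS = π '' (i ⁻¹' Set.range iL) →
        IsLagrangianSymplectic (s := s) ΩN iS := by
  obtain ⟨σ, hσ, hσπ⟩ := exists_symplectic_reduction hM hi hhor hleaf hπ
  refine ⟨⟨σ, ⟨hσ, hσπ⟩, fun τ hτ =>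
    eq_of_pullback_eq hπ hleaf.surjective (hτ.2.trans hσπ.symm)⟩, ?_⟩
  intro τ hτ l p s L _ _ _ _ _ P _ _ _ _ _ S _ _ _ _ _ iL jL jN iS _ hL hclean hS hrange
  refine isLagrangianSymplectic_of_range_eq (p := p) hτ.1
    (hπ.contMDiff.comp hclean.smooth_right)
    (formOrth_range_modelDeriv_eq hM hi hhor hcoiso hleaf hπ hτ.2 hL hclean) hS ?_
  -- It remains to see that `i ⁻¹' range iL = range jN`, which holds since `i ∘ jN` has image `L ∩
  -- N` and `i` is injective.
  rw [hrange, Set.range_comp]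
  congr 1
  ext x
  constructor
  · intro hx
    have hmem : i x ∈ Set.range (fun z => i (jN z)) := hclean.range_eq ▸ ⟨hx, x, rfl⟩
    obtain ⟨z, hz⟩ := hmem
    exact ⟨z, hi.injective hz⟩
  · rintro ⟨z, rfl⟩
    exact ⟨jL z, hclean.comm z⟩
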